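/- **Conventions.** $g_{\mu\nu}=g^{\mu\nu}=\mathrm{diag}(1,-1,-1,-1)$; $\sigma^0=1$ and $\sigma^{1,2,3}$ are the Pauli matrices, $\sigma_\mu=g_{\mu\nu}\sigma^\nu$; $\epsilon_{ab}=-\epsilon^{ab}$ is antisymmetric with $\epsilon_{12}=1$ (also for dotted indices), $\chi^a=\epsilon^{ab}\chi_b$. Repeated Minkowski and Weyl indices are summed. $D_m(x)=\frac{i}{(2\pi)^3}\int \mathrm{sgn}(p_0)\,\delta(p^2-m^2)\,e^{-ip\cdot x}\,d^4p$ is the Pauli–Jordan distribution, and $D_m=D_m(x-y)$ in the commutation relations below. **Setting.** Let $\mathcal H$ be a complex Hilbert space, with a dense invariant domain, a non-degenerate Hermitian sesquilinear form on it ($\dagger$ denotes the adjoint for this form), a form-preserving representation of the covering group $\mathbb R^4\rtimes SL(2,\mathbb C)$ of the proper orthochronous Poincaré group with generators $P_\mu$ of the translations, an invariant vacuum $\Omega\neq 0$, and supercharges $Q_a$, $\bar Q_{\bar a}=(Q_a)^\dagger$ ($a=1,2$), transforming as a Weyl spinor, with $Q_a\Omega=\bar Q_{\bar a}\Omega=0$,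 $$\{Q_a,Q_b\}=0,\quad \{Q_a,\bar Q_{\bar b}\}=2\sigma^\mu_{a\bar b}P_\mu,\quad [Q_a,P_\mu]=0 .$$ Let $v^{(j)}_\mu$ ($j=1,\dots,s$) and $\psi^{(A)}_{\mu a}$ ($A=1,\dots,f$), with $\bar\psi^{(A)}_{\mu\bar a}=(\psi^{(A)}_{\mu a})^\dagger$, be operator-valued tempered distributions on this domain, Poincaré covariant as vector fields and as vector-spinor fields respectively, with $[P_\mu,\varphi]=-i\partial_\mu\varphi$ for each of these fields $\varphi$. Suppose that $(v^{(j)}_\mu)^\dagger=v^{(j)}_\mu$, that with masses $m_j\ge 0$, $M_A\ge 0$ $$(\partial^2+m_j^2)v^{(j)}_\mu=0,\quad i\sigma^\nu_{a\bar b}\partial_\nu\bar\psi^{(A)\bar b}_\mu=M_A\psi^{(A)}_{\mu a},\quad -i\sigma^\nu_{a\bar b}\partial_\nu\psi_\mu^{(A)a}=M_A\bar\psi^{(A)}_{\mu\bar b},$$ and that $$[v^{(j)}_\mu(x),v^{(k)}_\rho(y)^\dagger]=2i\,\delta_{jk}g_{\mu\rho}D_{m_j},\qquad [v^{(j)}_\mu(x),\psi^{(A)}_{\rho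 a}(y)]=0,$$ $$\{\psi^{(A)}_{\mu a}(x),\psi^{(B)}_{\rho b}(y)\}=-i\,\delta_{AB}\,g_{\mu\rho}M_A\epsilon_{ab}D_{M_A},\qquad \{\psi^{(A)}_{\mu a}(x),\bar\psi^{(B)}_{\rho\bar b}(y)\}=-\delta_{AB}\,g_{\mu\rho}\,\sigma^\nu_{a\bar b}\,\partial_\nu D_{M_A}.$$ No transversality condition is imposed. Suppose that the supercharges act by $$i[Q_a,v^{(j)}_\mu]=\sum_{A=1}^f\Big[\mathcal A_1^{jA}\psi^{(A)}_{\mu a}+\mathcal A_4^{jA}(\sigma_\mu)_{a\bar b}\,\partial^\nu\bar\psi^{(A)\bar b}_\nu+\mathcal A_5^{jA}\sigma^\nu_{a\bar b}\,\partial_\mu\bar\psi^{(A)\bar b}_\nu\Big],$$ $$\{Q_a,\psi^{(A)}_{\mu b}\}=\epsilon_{ab}\sum_{j=1}^s\mathcal A_2^{Aj}v^{(j)}_\mu,\qquad \{Q_a,\bar\psi^{(A)}_{\mu\bar b}\}=\sum_{j=1}^s\mathcal A_3^{Aj}\sigma^\nu_{a\bar b}\,\partial_\nu v^{(j)}_\mu,$$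 with complex matrices $\mathcal A_1,\dots,\mathcal A_5$. **Claim.** Then $s=2f$. Put $v^{(A)}_\mu:=\sum_{j=1}^s\mathcal A_3^{Aj}v^{(j)}_\mu$ for $A=1,\dots,f$. The passage from the $s$ real fields $v^{(j)}_\mu$ to the fields $v^{(A)}_\mu$, $(v^{(A)}_\mu)^\dagger$ is invertible (the $s\times s$ matrix with the rows of $\mathcal A_3$ and $\overline{\mathcal A_3}$ is invertible). For each $A$, the pair $v_\mu=v^{(A)}_\mu$, $\psi_{\mu a}=\psi^{(A)}_{\mu a}$ is an *RS vector multiplet* of mass $M=M_A$: $v_\mu$ is a complex vector field and $\psi_{\mu a}$ a Majorana–Rarita–Schwinger field, $\bar\psi_{\mu\bar a}=(\psi_{\mu a})^\dagger$, such that $(\partial^2+M^2)v_\mu=0$, $\psi_\mu$ satisfies the above Dirac equations with mass $M$, $$[v_\mu(x),v_\rho^\dagger(y)]=2i g_{\mu\rho}D_M,\quad [v_\mu(x),v_\rho(y)]=0,\quad [v_\mu(x),\psi_{\rho a}(y)]=[v_\mu^\dagger(x),\psi_{\rho a}(y)]=0,$$ $$\{\psi_{\mu a}(x),\psi_{\rho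 b}(y)\}=-iM g_{\mu\rho}\epsilon_{ab}D_M,\quad \{\psi_{\mu a}(x),\bar\psi_{\rho\bar b}(y)\}=-g_{\mu\rho}\sigma^\nu_{a\bar b}\partial_\nu D_M,$$ and $$[Q_a,v_\mu]=0,\quad [\bar Q_{\bar a},v_\mu^\dagger]=0,\quad i[Q_a,v_\mu^\dagger]=2\psi_{\mu a},\quad i[\bar Q_{\bar a},v_\mu]=2\bar\psi_{\mu\bar a},$$ $$\{Q_a,\psi_{\mu b}\}=-i\epsilon_{ab}Mv_\mu,\quad \{\bar Q_{\bar a},\bar\psi_{\mu\bar b}\}=i\epsilon_{\bar a\bar b}Mv_\mu^\dagger,\quad \{Q_a,\bar\psi_{\mu\bar b}\}=\sigma^\nu_{a\bar b}\partial_\nu v_\mu,\quad \{\bar Q_{\bar a},\psi_{\mu b}\}=\sigma^\nu_{b\bar a}\partial_\nu v_\mu^\dagger .$$ For $A\neq B$ all graded commutators between the fields of the $A$-th and of the $B$-th multiplet vanish; thus the system is the direct sum of these $f$ multiplets. -/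

import Mathlib

/-! ## Minkowski and Weyl conventions -/

namespace RSSusy

/-- Points of Minkowski space, with contravariant coordinates `x^0, x^1, x^2, x^3`; the Euclidean
structure serves only to define Schwartz functions and Lebesgue measure. -/
abbrev Spacetime := EuclideanSpace ℝ (Fin 4)

/-- Test functions: Schwartz functions on spacetime. -/
abbrev TestFn := SchwartzMap Spacetime ℂ

/-- The Minkowski metric, with diagonal `1, -1, -1, -1`; `g^{μν}` has the same entries. -/
def metric (μ ν : Fin 4) : ℝ := if μ = ν then (if μ = 0 then 1 else -1) else 0

/-- `σ^μ` (upper Minkowski index, lower Weyl indices): the unit matrix and the Pauli matrices. -/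
noncomputable def sigma : Fin 4 → Matrix (Fin 2) (Fin 2) ℂ :=
  ![!![1, 0; 0, 1], !![0, 1; 1, 0], !![0, -Complex.I; Complex.I, 0], !![1, 0; 0, -1]]

/-- `σ_μ = g_{μν} σ^ν`. -/
noncomputable def sigmaLow (μ : Fin 4) : Matrix (Fin 2) (Fin 2) ℂ := (metric μ μ : ℂ) • sigma μ

/-- `ε_{ab}` with `ε_{12} = 1`, for undotted and for dotted Weyl indices. -/
def eps : Matrix (Fin 2) (Fin 2) ℂ := !![0, 1; -1, 0]

/-- `ε^{ab} = - ε_{ab}`. -/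
def epsUp : Matrix (Fin 2) (Fin 2) ℂ := -eps

/-- The real matrix `T(A)` with `A σ^μ A^* = ∑ ν, T(A)^μ_ν σ^ν`, read off from
`tr (σ^ν σ^κ) = 2 δ^{νκ}`. -/
noncomputable def lorentz (A : Matrix.SpecialLinearGroup (Fin 2) ℂ) : Matrix (Fin 4) (Fin 4) ℝ :=
  fun μ ν => ((sigma ν * (A.1 * sigma μ * A.1.conjTranspose)).trace / 2).re

/-! ## Operator-valued distributions -/

section Fields

variable {D : Type*} [AddCommGroup D] [Module ℂ D]

/-- A field with invariant domain `D`: a linear map from test functions to operators on `D`,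
`g ↦ φ(g) = ∫ φ(x) g(x) dx`. -/
abbrev Field (D : Type*) [AddCommGroup D] [Module ℂ D] := TestFn →ₗ[ℂ] Module.End ℂ D

/-- `∂_ν φ` in the sense of distributions, `(∂_ν φ)(g) = - φ(∂_ν g)`. -/
noncomputable def pd (ν : Fin 4) (φ : Field D) : Field D :=
  -(φ ∘ₗ (LineDeriv.lineDerivOpCLM ℂ TestFn
    (EuclideanSpace.single ν (1 : ℝ) : Spacetime)).toLinearMap)

/-- `∂^ν φ = g^{νν} ∂_ν φ`. -/
noncomputable def pdUp (ν : Fin 4) (φ : Field D) : Field D := (metric ν ν : ℂ) • pd ν φ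

/-- `∂^2 φ = ∂^ν ∂_ν φ`. -/
noncomputable def box (φ : Field D) : Field D := ∑ ν, pdUp ν (pd ν φ)

/-- `σ^ν_{ab} ∂_ν φ`. -/
noncomputable def sigmaD (a b : Fin 2) (φ : Field D) : Field D := ∑ ν, sigma ν a b • pd ν φ

/-- Raising a Weyl index: `χ^a = ε^{ab} χ_b`. -/
noncomputable def raise (χ : Fin 2 → Field D) (a : Fin 2) : Field D := ∑ b, epsUp a b • χ b

/-- The field `g ↦ [X, φ(g)]`. -/
noncomputable def comm (X : Module.End ℂ D) (φ : Field D) : Field D :=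
  (LinearMap.mulLeft ℂ X - LinearMap.mulRight ℂ X) ∘ₗ φ

/-- The field `g ↦ {X, φ(g)}`. -/
noncomputable def anticomm (X : Module.End ℂ D) (φ : Field D) : Field D :=
  (LinearMap.mulLeft ℂ X + LinearMap.mulRight ℂ X) ∘ₗ φ

/-- `[φ(x), χ(y)] = K(x, y) 1`, smeared with test functions. -/
def CommIs (φ χ : Field D) (K : TestFn → TestFn → ℂ) : Prop :=
  ∀ g h : TestFn, φ g * χ h - χ h * φ g = K g h • (1 : Module.End ℂ D)

/-- `{φ(x), χ(y)} = K(x, y) 1`, smeared with test functions. -/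
def AnticommIs (φ χ : Field D) (K : TestFn → TestFn → ℂ) : Prop :=
  ∀ g h : TestFn, φ g * χ h + χ h * φ g = K g h • (1 : Module.End ℂ D)

/-- The Klein-Gordon equation `(∂^2 + m^2) φ = 0`. -/
def KleinGordon (m : ℝ) (φ : Field D) : Prop := box φ + ((m ^ 2 : ℝ) : ℂ) • φ = 0

/-- The Dirac equations
`i σ^ν_{ab} ∂_ν ψbar^b = M ψ_a` and `- i σ^ν_{ab} ∂_ν ψ^a = M ψbar_b`. -/
def Dirac (M : ℝ) (ψ ψbar : Fin 2 → Field D) : Prop :=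
  (∀ a, Complex.I • ∑ b, sigmaD a b (raise ψbar b) = (M : ℂ) • ψ a) ∧
  (∀ b, -Complex.I • ∑ a, sigmaD a b (raise ψ a) = (M : ℂ) • ψbar b)

end Fields

/-! ## The Pauli-Jordan distribution -/

/-- `∫ exp(- i (p_0 x^0 - p · x)) g(x) dx`. -/
noncomputable def minkowskiFourier (g : TestFn) (p0 : ℝ) (p : EuclideanSpace ℝ (Fin 3)) : ℂ :=
  ∫ x : Spacetime,
    Complex.exp (-Complex.I * ((p0 * x 0 - ∑ i : Fin 3, p i * x i.succ : ℝ) : ℂ)) * g x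

/-- `ω(p) = (m^2 + p^2)^{1/2}`. -/
noncomputable def energy (m : ℝ) (p : EuclideanSpace ℝ (Fin 3)) : ℝ :=
  Real.sqrt (m ^ 2 + ‖p‖ ^ 2)

/-- The Pauli-Jordan distribution `D_m(x) = i (2π)^{-3} ∫ sgn(p_0) δ(p^2 - m^2) e^{-ipx} d^4p`,
smeared in its two arguments: the value is `∫∫ D_m(x - y) g(x) h(y) dx dy`. -/
noncomputable def pauliJordan (m : ℝ) (g h : TestFn) : ℂ :=
  Complex.I / ((2 * Real.pi) ^ 3 : ℝ) *
    ∫ p : EuclideanSpace ℝ (Fin 3), ((1 / (2 * energy m p) : ℝ) : ℂ) *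
      (minkowskiFourier g (energy m p) p * minkowskiFourier h (-energy m p) (-p)
        - minkowskiFourier g (-energy m p) (-p) * minkowskiFourier h (energy m p) p)

/-- `∫∫ (∂_ν D_m)(x - y) g(x) h(y) dx dy`. -/
noncomputable def pauliJordanD (ν : Fin 4) (m : ℝ) (g h : TestFn) : ℂ :=
  -pauliJordan m
    (LineDeriv.lineDerivOpCLM ℂ TestFn (EuclideanSpace.single ν (1 : ℝ) : Spacetime) g) h

/-! ## Supersymmetric quantum theories -/

/-- A supersymmetric quantum theory on a Hilbert space `H`, in the indefinite metric formalism: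
an invariant dense domain, a non-degenerate Hermitian sesquilinear form on it, a representation of
the covering group of the proper orthochronous Poincaré group, a vacuum, and supercharges
`Q_a` with adjoints `Qbar_a` satisfying the N = 1 supersymmetry algebra. -/
structure SusyTheory (H : Type*) [NormedAddCommGroup H] [InnerProductSpace ℂ H] where
  dom : Submodule ℂ H
  dense_dom : Dense (dom : Set H)
  /-- The form `⟨·, ·⟩` with respect to which adjoints are taken. -/
  form : dom →ₗ⋆[ℂ] dom →ₗ[ℂ] ℂ
  form_symm : ∀ x y, (starRingEnd ℂ) (form x y) = form y x
  form_nondeg : ∀ x, (∀ y, form x y = 0) → x = 0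
  /-- Translations `U_a`. -/
  trans : Multiplicative Spacetime →* Module.End ℂ dom
  /-- The representation `U_A` of `SL(2, ℂ)`. -/
  boost : Matrix.SpecialLinearGroup (Fin 2) ℂ →* Module.End ℂ dom
  form_trans : ∀ a x y, form (trans a x) (trans a y) = form x y
  form_boost : ∀ A x y, form (boost A x) (boost A y) = form x y
  /-- The two representations form one of the semidirect product:
  `U_A^{-1} U_a U_A = U_{T(A) a}`. -/
  boost_trans : ∀ (A : Matrix.SpecialLinearGroup (Fin 2) ℂ) (a : Spacetime),
    boost A⁻¹ * trans (Multiplicative.ofAdd a) * boost A =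
      trans (Multiplicative.ofAdd (WithLp.toLp 2 ((lorentz A).mulVec a.ofLp)))
  /-- The generators: `U_a = exp(i a^μ P_μ)`. -/
  P : Fin 4 → Module.End ℂ dom
  generator : ∀ μ (x : dom), HasDerivAt
    (fun t : ℝ => ((trans (Multiplicative.ofAdd (EuclideanSpace.single μ t)) x : dom) : H))
    (Complex.I • ((P μ x : dom) : H)) 0
  vac : dom
  vac_ne_zero : vac ≠ 0
  trans_vac : ∀ a, trans a vac = vac
  boost_vac : ∀ A, boost A vac = vac
  Q : Fin 2 → Module.End ℂ dom
  Qbar : Fin 2 → Module.End ℂ dom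
  Q_adjoint : ∀ a x y, form (Q a x) y = form x (Qbar a y)
  Q_vac : ∀ a, Q a vac = 0
  Qbar_vac : ∀ a, Qbar a vac = 0
  Q_Q : ∀ a b, Q a * Q b + Q b * Q a = 0
  Q_Qbar : ∀ a b, Q a * Qbar b + Qbar b * Q a = ∑ μ, (2 * sigma μ a b) • P μ
  Q_P : ∀ a μ, Q a * P μ - P μ * Q a = 0
  Q_covariant : ∀ A b, boost A⁻¹ * Q b * boost A = ∑ c, (A.1 b c) • Q c

section Theory

variable {H : Type*} [NormedAddCommGroup H] [InnerProductSpace ℂ H]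

/-- Complex conjugation of test functions. -/
noncomputable def conjTest (g : TestFn) : TestFn :=
  SchwartzMap.postcompCLM (𝕜 := ℝ) (Complex.conjCLE : ℂ →L[ℝ] ℂ) g

/-- `φ(x)^† = φ'(x)` with respect to the form of the theory, and conversely. -/
def IsFieldAdjoint (T : SusyTheory H) (φ φ' : Field T.dom) : Prop :=
  ∀ (g : TestFn) (x y : T.dom), T.form (φ g x) y = T.form x (φ' (conjTest g) y)

/-- `φ` is an operator-valued tempered distribution which transforms under translations by
`U_a φ(x) U_a^{-1} = φ(x + a)`, that is, infinitesimally, by `[P_μ, φ] = - i ∂_μ φ`. -/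
structure IsQuantumField (T : SusyTheory H) (φ : Field T.dom) : Prop where
  tempered : ∀ x y : T.dom, Continuous fun g : TestFn => inner ℂ (x : H) ((φ g y : T.dom) : H)
  translate : ∀ (a : Spacetime) (g g' : TestFn), (∀ x, g' (x + a) = g x) →
    T.trans (Multiplicative.ofAdd a) * φ g * T.trans (Multiplicative.ofAdd (-a)) = φ g'
  momentum : ∀ μ, comm (T.P μ) φ = -Complex.I • pd μ φ

/-- `v_μ` transforms as a vector field:
`U_A^{-1} v_μ(x) U_A = ∑ ρ, T(A)^ρ_μ v_ρ(T(A) x)`. -/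
def IsVectorField (T : SusyTheory H) (v : Fin 4 → Field T.dom) : Prop :=
  ∀ (A : Matrix.SpecialLinearGroup (Fin 2) ℂ) (g g' : TestFn),
    (∀ x : Spacetime, g' (WithLp.toLp 2 ((lorentz A).mulVec x.ofLp)) = g x) →
    ∀ μ, T.boost A⁻¹ * v μ g * T.boost A = ∑ ρ, (lorentz A ρ μ : ℂ) • v ρ g'

/-- `ψ_{μ a}` transforms as a vector in `μ` and as a spinor in `a`:
`U_A^{-1} ψ_{μ a}(x) U_A = ∑ ρ c, T(A)^ρ_μ A_a^c ψ_{ρ c}(T(A) x)`. -/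
def IsVectorSpinorField (T : SusyTheory H) (ψ : Fin 4 → Fin 2 → Field T.dom) : Prop :=
  ∀ (A : Matrix.SpecialLinearGroup (Fin 2) ℂ) (g g' : TestFn),
    (∀ x : Spacetime, g' (WithLp.toLp 2 ((lorentz A).mulVec x.ofLp)) = g x) →
    ∀ μ a, T.boost A⁻¹ * ψ μ a g * T.boost A =
      ∑ ρ, ∑ c, ((lorentz A ρ μ : ℂ) * A.1 a c) • ψ ρ c g'

/-- A system of `s` real free vector fields `v_μ^{(j)}` of masses `m_j` and `f` free
Majorana-Rarita-Schwinger fields `ψ_{μ a}^{(A)}` of masses `M_A`, without transversality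
conditions. -/
structure VectorRSFields (T : SusyTheory H) (s f : ℕ) where
  m : Fin s → ℝ
  M : Fin f → ℝ
  m_nonneg : ∀ j, 0 ≤ m j
  M_nonneg : ∀ A, 0 ≤ M A
  v : Fin s → Fin 4 → Field T.dom
  ψ : Fin f → Fin 4 → Fin 2 → Field T.dom
  ψbar : Fin f → Fin 4 → Fin 2 → Field T.dom
  v_field : ∀ j μ, IsQuantumField T (v j μ)
  ψ_field : ∀ A μ a, IsQuantumField T (ψ A μ a)
  ψbar_field : ∀ A μ a, IsQuantumField T (ψbar A μ a)
  v_vector : ∀ j, IsVectorField T (v j)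
  ψ_vectorSpinor : ∀ A, IsVectorSpinorField T (ψ A)
  v_hermitian : ∀ j μ, IsFieldAdjoint T (v j μ) (v j μ)
  ψ_majorana : ∀ A μ a, IsFieldAdjoint T (ψ A μ a) (ψbar A μ a)
  v_kleinGordon : ∀ j μ, KleinGordon (m j) (v j μ)
  ψ_dirac : ∀ A μ, Dirac (M A) (ψ A μ) (ψbar A μ)
  /-- Here `v_ρ^{(k)†} = v_ρ^{(k)}`. -/
  ccr_v_v : ∀ j k μ ρ, CommIs (v j μ) (v k ρ) fun g h =>
    if j = k then 2 * Complex.I * metric μ ρ * pauliJordan (m j) g h else 0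
  ccr_ψ_ψ : ∀ A B μ ρ a b, AnticommIs (ψ A μ a) (ψ B ρ b) fun g h =>
    if A = B then -Complex.I * metric μ ρ * M A * eps a b * pauliJordan (M A) g h else 0
  ccr_ψ_ψbar : ∀ A B μ ρ a b, AnticommIs (ψ A μ a) (ψbar B ρ b) fun g h =>
    if A = B then -(metric μ ρ * ∑ ν, sigma ν a b * pauliJordanD ν (M A) g h) else 0
  ccr_v_ψ : ∀ j A μ ρ a, CommIs (v j μ) (ψ A ρ a) fun _ _ => 0

/-- The reduced form of the action of the supercharges, with coefficient matrices
`A1, A2, A3, A4, A5`: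
* `i [Q_a, v_μ^{(j)}] = ∑_A (A1^{jA} ψ_{μ a}^{(A)} + A4^{jA} (σ_μ)_{ab} ∂^ν ψbar_ν^{(A) b}
  + A5^{jA} σ^ν_{ab} ∂_μ ψbar_ν^{(A) b})`,
* `{Q_a, ψ_{μ b}^{(A)}} = ε_{ab} ∑_j A2^{Aj} v_μ^{(j)}`,
* `{Q_a, ψbar_{μ b}^{(A)}} = ∑_j A3^{Aj} σ^ν_{ab} ∂_ν v_μ^{(j)}`. -/
structure VectorRSFields.ReducedAction {T : SusyTheory H} {s f : ℕ} (X : VectorRSFields T s f)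
    (A1 : Matrix (Fin s) (Fin f) ℂ) (A2 A3 : Matrix (Fin f) (Fin s) ℂ)
    (A4 A5 : Matrix (Fin s) (Fin f) ℂ) : Prop where
  Q_v : ∀ a j μ, Complex.I • comm (T.Q a) (X.v j μ) =
    ∑ A, (A1 j A • X.ψ A μ a
      + A4 j A • ∑ b, sigmaLow μ a b • ∑ ν, pdUp ν (raise (X.ψbar A ν) b)
      + A5 j A • ∑ ν, ∑ b, sigma ν a b • pd μ (raise (X.ψbar A ν) b))
  Q_ψ : ∀ a A μ b, anticomm (T.Q a) (X.ψ A μ b) = ∑ j, (eps a b * A2 A j) • X.v j μ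
  Q_ψbar : ∀ a A μ b, anticomm (T.Q a) (X.ψbar A μ b) = ∑ j, A3 A j • sigmaD a b (X.v j μ)

/-- The RS vector multiplet of mass `M`: a complex vector field `v_μ`, with adjoint `vdag_μ`, and a
Majorana-Rarita-Schwinger field `ψ_{μ a}`, with adjoint `ψbar_{μ a}`. -/
structure IsRSVectorMultiplet (T : SusyTheory H) (M : ℝ) (v vdag : Fin 4 → Field T.dom)
    (ψ ψbar : Fin 4 → Fin 2 → Field T.dom) : Prop where
  v_field : ∀ μ, IsQuantumField T (v μ)
  vdag_field : ∀ μ, IsQuantumField T (vdag μ)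
  ψ_field : ∀ μ a, IsQuantumField T (ψ μ a)
  ψbar_field : ∀ μ a, IsQuantumField T (ψbar μ a)
  v_vector : IsVectorField T v
  ψ_vectorSpinor : IsVectorSpinorField T ψ
  v_adjoint : ∀ μ, IsFieldAdjoint T (v μ) (vdag μ)
  ψ_majorana : ∀ μ a, IsFieldAdjoint T (ψ μ a) (ψbar μ a)
  kleinGordon : ∀ μ, KleinGordon M (v μ)
  dirac : ∀ μ, Dirac M (ψ μ) (ψbar μ)
  ccr_v_vdag : ∀ μ ρ, CommIs (v μ) (vdag ρ) fun g h =>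
    2 * Complex.I * metric μ ρ * pauliJordan M g h
  ccr_v_v : ∀ μ ρ, CommIs (v μ) (v ρ) fun _ _ => 0
  ccr_ψ_ψ : ∀ μ ρ a b, AnticommIs (ψ μ a) (ψ ρ b) fun g h =>
    -Complex.I * M * metric μ ρ * eps a b * pauliJordan M g h
  ccr_ψ_ψbar : ∀ μ ρ a b, AnticommIs (ψ μ a) (ψbar ρ b) fun g h =>
    -(metric μ ρ * ∑ ν, sigma ν a b * pauliJordanD ν M g h)
  ccr_v_ψ : ∀ μ ρ a, CommIs (v μ) (ψ ρ a) fun _ _ => 0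
  ccr_vdag_ψ : ∀ μ ρ a, CommIs (vdag μ) (ψ ρ a) fun _ _ => 0
  Q_v : ∀ a μ, comm (T.Q a) (v μ) = 0
  Qbar_vdag : ∀ a μ, comm (T.Qbar a) (vdag μ) = 0
  Q_vdag : ∀ a μ, Complex.I • comm (T.Q a) (vdag μ) = (2 : ℂ) • ψ μ a
  Qbar_v : ∀ a μ, Complex.I • comm (T.Qbar a) (v μ) = (2 : ℂ) • ψbar μ a
  Q_ψ : ∀ a b μ, anticomm (T.Q a) (ψ μ b) = (-Complex.I * eps a b * M) • v μ
  Qbar_ψbar : ∀ a b μ, anticomm (T.Qbar a) (ψbar μ b) = (Complex.I * eps a b * M) • vdag μ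
  Q_ψbar : ∀ a b μ, anticomm (T.Q a) (ψbar μ b) = sigmaD a b (v μ)
  Qbar_ψ : ∀ a b μ, anticomm (T.Qbar a) (ψ μ b) = sigmaD b a (vdag μ)

/-- All graded commutators between the fields of two multiplets vanish (those with a barred
field on the left follow by taking adjoints). -/
structure Decoupled {D : Type*} [AddCommGroup D] [Module ℂ D]
    (v vdag : Fin 4 → Field D) (ψ : Fin 4 → Fin 2 → Field D)
    (v' vdag' : Fin 4 → Field D) (ψ' ψbar' : Fin 4 → Fin 2 → Field D) : Prop where
  v_v : ∀ μ ρ, CommIs (v μ) (v' ρ) fun _ _ => 0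
  v_vdag : ∀ μ ρ, CommIs (v μ) (vdag' ρ) fun _ _ => 0
  v_ψ : ∀ μ ρ a, CommIs (v μ) (ψ' ρ a) fun _ _ => 0
  vdag_ψ : ∀ μ ρ a, CommIs (vdag μ) (ψ' ρ a) fun _ _ => 0
  ψ_ψ : ∀ μ ρ a b, AnticommIs (ψ μ a) (ψ' ρ b) fun _ _ => 0
  ψ_ψbar : ∀ μ ρ a b, AnticommIs (ψ μ a) (ψbar' ρ b) fun _ _ => 0

/-- `v_μ^{(A)} = ∑_j A3^{Aj} v_μ^{(j)}`. -/
noncomputable def VectorRSFields.complexV {T : SusyTheory H} {s f : ℕ} (X : VectorRSFields T s f)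
    (A3 : Matrix (Fin f) (Fin s) ℂ) (A : Fin f) (μ : Fin 4) : Field T.dom :=
  ∑ j, A3 A j • X.v j μ

/-- `v_μ^{(A)†} = ∑_j conj(A3^{Aj}) v_μ^{(j)}`. -/
noncomputable def VectorRSFields.complexVdag {T : SusyTheory H} {s f : ℕ}
    (X : VectorRSFields T s f)
    (A3 : Matrix (Fin f) (Fin s) ℂ) (A : Fin f) (μ : Fin 4) : Field T.dom :=
  ∑ j, (starRingEnd ℂ) (A3 A j) • X.v j μ

end Theory

end RSSusy

/-! ## Momentum space form of the Pauli-Jordan distribution -/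

namespace RSSusy

open scoped FourierTransform SchwartzMap LineDeriv ContDiff Topology

/-! Locality turns the ansatz for the supercharges into linear algebra. The Jacobi identities of `Q`
with one vector and one spinor field compare c-number kernels, each a constant-coefficient
differential operator applied to a Pauli–Jordan distribution. Such kernels are independent
(`sum_symbol_eq_zero`): `D_m` lives on the shell `k² = m²` in momentum space, shells of distinct
masses are disjoint, and on one shell an operator acts by multiplication with its symbol. This
yields `A4 = A5 = 0` (`A4_A5_eq_zero`), `A1 = 2 A3ᵀ` with `m_j = M_A` wherever `A3 A j ≠ 0`
(`A1_A3`), and `A2 A j = -i M_A (A3 A j)` (`A2_eq`). So `A3` determines the action of `Q` and, by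
adjoints, that of `Qbar`.

The supersymmetry algebra then constrains `A3`: `{Q, Q} = 0` on `ψbar` gives `A3 A3ᵀ = 0`; `{Q,
Qbar} = 2σP` gives `A3 A3* = 1` on `ψ`, and on `v` it gives `A3* A3` plus its complex conjugate
equal to `1`. Together these say that the matrix `U` with the rows of `A3` and of its conjugate
satisfies `U U* = 1` and `U* U = 1`. Hence `U` is square, `s = 2f`, and the change of fields is
invertible; the same orthogonality relations, with the matching of masses, split the system into
multiplets. -/

/-- The partial derivative `∂_ν` on test functions. -/
noncomputable abbrev testD (ν : Fin 4) (g : TestFn) : TestFn :=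
  LineDeriv.lineDerivOpCLM ℂ TestFn (EuclideanSpace.single ν (1 : ℝ) : Spacetime) g

/-- The covariant components `(p_0, -p)` of a four-momentum. -/
noncomputable def covariant (p0 : ℝ) (p : EuclideanSpace ℝ (Fin 3)) : Spacetime :=
  WithLp.toLp 2 (Fin.cons p0 fun i => -p i)

@[simp] theorem covariant_zero (p0 : ℝ) (p : EuclideanSpace ℝ (Fin 3)) :
    covariant p0 p 0 = p0 := rfl

@[simp] theorem covariant_succ (p0 : ℝ) (p : EuclideanSpace ℝ (Fin 3)) (i : Fin 3) :
    covariant p0 p i.succ = -p i := rfl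

theorem covariant_neg (p0 : ℝ) (p : EuclideanSpace ℝ (Fin 3)) :
    covariant (-p0) (-p) = -covariant p0 p := by
  ext i
  refine Fin.cases ?_ (fun i => ?_) i <;> simp

/-- Covariant components turn the Minkowski pairing into the Euclidean one; the factor `(2π)⁻¹`
absorbs the normalisation `exp(-2πi⟨x, k⟩)` of `𝓕`. -/
theorem minkowskiFourier_eq (g : TestFn) (p0 : ℝ) (p : EuclideanSpace ℝ (Fin 3)) :
    minkowskiFourier g p0 p = 𝓕 g ((2 * Real.pi)⁻¹ • covariant p0 p) := by
  rw [SchwartzMap.fourier_coe, Real.fourier_eq', minkowskiFourier]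
  refine MeasureTheory.integral_congr_ae (.of_forall fun x => ?_)
  have h : inner ℝ x ((2 * Real.pi)⁻¹ • covariant p0 p)
      = (2 * Real.pi)⁻¹ * (p0 * x 0 - ∑ i : Fin 3, p i * x i.succ) := by
    rw [inner_smul_right, PiLp.inner_apply, Fin.sum_univ_succ]
    simp [Finset.sum_neg_distrib, sub_eq_add_neg]
  simp only [h, smul_eq_mul]
  congr 2
  have := Real.pi_ne_zero
  rw [show -2 * Real.pi * ((2 * Real.pi)⁻¹ * (p0 * x 0 - ∑ i : Fin 3, p i * x i.succ))
    = -(p0 * x 0 - ∑ i : Fin 3, p i * x i.succ) by field_simp]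
  push_cast
  ring

theorem minkowskiFourier_testD (ν : Fin 4) (g : TestFn) (p0 : ℝ)
    (p : EuclideanSpace ℝ (Fin 3)) :
    minkowskiFourier (testD ν g) p0 p
      = Complex.I * (covariant p0 p ν : ℂ) * minkowskiFourier g p0 p := by
  rw [minkowskiFourier_eq, minkowskiFourier_eq, testD, LineDeriv.lineDerivOpCLM_apply,
    SchwartzMap.fourier_lineDerivOp_eq, smul_apply,
    SchwartzMap.smulLeftCLM_apply_apply (by fun_prop)]
  have := Real.pi_ne_zero
  have h : inner ℝ ((2 * Real.pi)⁻¹ • covariant p0 p) (EuclideanSpace.single ν (1 : ℝ))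
      = (2 * Real.pi)⁻¹ * covariant p0 p ν := by
    simp [EuclideanSpace.inner_single_right]
  rw [h, Complex.real_smul, smul_eq_mul]
  push_cast
  field_simp

/-- Every smooth compactly supported function on momentum space is the Fourier transform of a
test function. -/
theorem exists_minkowskiFourier_eq {u : Spacetime → ℝ} (hu : HasCompactSupport u)
    (hu' : ContDiff ℝ ∞ u) :
    ∃ g : TestFn, ∀ p0 p, minkowskiFourier g p0 p = u (covariant p0 p) := by
  have hpi : (2 * Real.pi) ≠ 0 := by simp [Real.pi_ne_zero]
  have h₁ : HasCompactSupport fun k : Spacetime => (u ((2 * Real.pi) • k) : ℂ) :=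
    (hu.comp_smul hpi).comp_left (g := ((↑) : ℝ → ℂ)) rfl
  have h₂ : ContDiff ℝ ∞ fun k : Spacetime => (u ((2 * Real.pi) • k) : ℂ) :=
    Complex.ofRealCLM.contDiff.comp (hu'.comp (contDiff_const_smul _))
  refine ⟨𝓕⁻ (h₁.toSchwartzMap h₂), fun p0 p => ?_⟩
  rw [minkowskiFourier_eq, FourierTransform.fourier_fourierInv_eq]
  simp [smul_smul, -mul_inv_rev]

/-! ### The mass shell -/

theorem energy_nonneg (m : ℝ) (p : EuclideanSpace ℝ (Fin 3)) : 0 ≤ energy m p :=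
  Real.sqrt_nonneg _

theorem continuous_energy (m : ℝ) : Continuous (energy m) := by
  unfold energy
  fun_prop

theorem continuous_covariant_energy (m : ℝ) :
    Continuous fun p : EuclideanSpace ℝ (Fin 3) => covariant (energy m p) p := by
  refine (PiLp.continuous_toLp 2 _).comp (continuous_pi fun i => ?_)
  refine Fin.cases ?_ (fun i => ?_) i
  · exact continuous_energy m
  · simp only [Fin.cons_succ]
    fun_prop

/-- The spatial part, with its sign reversed, is a continuous left inverse. Compact supports in
momentum space thus pull back to compact supports on the shell. -/
theorem isClosedEmbedding_covariant_energy (m : ℝ) : Topology.IsClosedEmbedding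
    fun p : EuclideanSpace ℝ (Fin 3) => covariant (energy m p) p := by
  refine Function.LeftInverse.isClosedEmbedding
    (f := fun k : Spacetime => WithLp.toLp 2 fun i : Fin 3 => -k i.succ) (fun p => ?_)
    (by fun_prop) (continuous_covariant_energy m)
  ext i
  simp

/-- `k_0^2 - k_1^2 - k_2^2 - k_3^2`. -/
def minkowskiSq (k : Spacetime) : ℝ := k 0 ^ 2 - ∑ i : Fin 3, k i.succ ^ 2

theorem minkowskiSq_covariant_energy (m : ℝ) (p : EuclideanSpace ℝ (Fin 3)) :
    minkowskiSq (covariant (energy m p) p) = m ^ 2 := by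
  simp only [minkowskiSq, covariant_zero, covariant_succ, energy,
    Real.sq_sqrt (add_nonneg (sq_nonneg m) (sq_nonneg ‖p‖))]
  simp [EuclideanSpace.norm_sq_eq]

/-- The two test functions are evaluated at opposite momenta, where the symbol of `∂_ν` changes
sign; this reflects that `D_m` depends on `x - y` only. -/
theorem pauliJordan_testD_right (m : ℝ) (ν : Fin 4) (g h : TestFn) :
    pauliJordan m g (testD ν h) = -pauliJordan m (testD ν g) h := by
  rw [pauliJordan, pauliJordan, ← mul_neg, ← MeasureTheory.integral_neg]
  congr 2
  ext p
  simp only [minkowskiFourier_testD, covariant_neg]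
  simp
  ring

/-- Nondegeneracy of the mass shell integrals: if a linear combination of
Pauli-Jordan distributions, with differential operators `D_i` of symbol `P_i` applied to them,
vanishes, then the symbols of the terms of mass `M` cancel on the mass shell of mass `M`. -/
theorem sum_symbol_eq_zero {ι : Type*} [Fintype ι] (m : ι → ℝ) (hm : ∀ i, 0 ≤ m i) (c : ι → ℂ)
    (D : ι → TestFn → TestFn) (P : ι → Spacetime → ℂ) (hP : ∀ i, Continuous (P i))
    (hD : ∀ i g p0 p, minkowskiFourier (D i g) p0 p
      = P i (covariant p0 p) * minkowskiFourier g p0 p)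
    (h0 : ∀ g h, ∑ i, c i * pauliJordan (m i) (D i g) h = 0)
    {M : ℝ} (hM : 0 ≤ M) {p : EuclideanSpace ℝ (Fin 3)} (hp : 0 < energy M p) :
    ∑ i, (if m i = M then c i * P i (covariant (energy M p) p) else 0) = 0 := by
  by_contra hS
  set S : Spacetime → ℂ := fun k => ∑ i, if m i = M then c i * P i k else 0 with hSdef
  have hScont : Continuous S := by
    refine continuous_finsetSum _ fun i _ => ?_
    split_ifs
    · exact continuous_const.mul (hP i)
    · exact continuous_const
  set k₀ := covariant (energy M p) p with hk₀
  change S k₀ ≠ 0 at hS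
  -- Near `k₀` the energy is positive, `S` stays in the half plane around `S k₀`, and all shells of
  -- mass other than `M` are avoided; a bump `u` is placed there.
  have hU : {k : Spacetime | 0 < k 0 ∧ 0 < ((starRingEnd ℂ) (S k₀) * S k).re ∧
      ∀ i, m i ≠ M → minkowskiSq k ≠ m i ^ 2} ∈ 𝓝 k₀ := by
    have hsq : Continuous minkowskiSq := by unfold minkowskiSq; fun_prop
    refine Filter.inter_mem ?_ (Filter.inter_mem ?_ ?_)
    · exact (isOpen_lt continuous_const (PiLp.continuous_apply 2 _ 0)).mem_nhds hp
    · refine (isOpen_lt continuous_const (Complex.continuous_re.comp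
        (continuous_const.mul hScont))).mem_nhds ?_
      change 0 < ((starRingEnd ℂ) (S k₀) * S k₀).re
      rw [mul_comm, Complex.mul_conj, Complex.ofReal_re]
      exact Complex.normSq_pos.2 hS
    · refine Filter.eventually_all.2 fun i => ?_
      by_cases hi : m i = M
      · simp [hi]
      · have : minkowskiSq k₀ ≠ m i ^ 2 := by
          rw [hk₀, minkowskiSq_covariant_energy]
          exact fun h => hi ((sq_eq_sq₀ (hm i) hM).1 h.symm)
        filter_upwards [(isOpen_ne_fun hsq continuous_const).mem_nhds this] with k hk _ using hk
  obtain ⟨u, hsub, hcomp, hsmooth, -, hone⟩ := exists_contDiff_tsupport_subset (n := ⊤) hU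
  have hu0 : ∀ k : Spacetime, k 0 ≤ 0 → u k = 0 := fun k hk => by
    by_contra hne
    exact absurd (hsub (subset_tsupport u hne)).1 (not_lt.2 hk)
  obtain ⟨g, hg⟩ := exists_minkowskiFourier_eq hcomp hsmooth
  have hcomp' : HasCompactSupport fun k => u (-k) :=
    hcomp.comp_homeomorph (Homeomorph.neg Spacetime)
  -- The transform of `h` is reflected because `pauliJordan` evaluates it at the momentum opposite
  -- to that of `g`; the first term then contains `u²`.
  obtain ⟨h, hh⟩ := exists_minkowskiFourier_eq hcomp' (hsmooth.comp contDiff_neg)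
  set C : ℂ := Complex.I / ((2 * Real.pi) ^ 3 : ℝ) with hC
  have hCne : C ≠ 0 := by
    rw [hC]
    refine div_ne_zero Complex.I_ne_zero ?_
    have := Real.pi_pos
    exact_mod_cast (by positivity : (2 * Real.pi) ^ 3 ≠ 0)
  set w : EuclideanSpace ℝ (Fin 3) → ℝ := fun q =>
    1 / (2 * energy M q) * u (covariant (energy M q) q) ^ 2 with hw
  have hK : ∀ i, pauliJordan (m i) (D i g) h = C * ∫ q : EuclideanSpace ℝ (Fin 3),
      (((1 / (2 * energy (m i) q) * u (covariant (energy (m i) q) q) ^ 2 : ℝ) : ℂ)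
        * P i (covariant (energy (m i) q) q)) := by
    intro i
    rw [pauliJordan, hC]
    congr 2
    ext q
    -- The second term sits at negative energy, where `u` vanishes.
    have hz : u (-covariant (energy (m i) q) q) = 0 :=
      hu0 _ (by simpa using energy_nonneg (m i) q)
    simp only [hD, hg, hh, covariant_neg, hz, neg_neg]
    push_cast
    ring
  have hK0 : ∀ i, m i ≠ M → pauliJordan (m i) (D i g) h = 0 := by
    intro i hi
    rw [hK i, MeasureTheory.integral_eq_zero_of_ae (.of_forall fun q => ?_), mul_zero]
    have hz : u (covariant (energy (m i) q) q) = 0 := by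
      by_contra hne
      exact (hsub (subset_tsupport u hne)).2.2 i hi (minkowskiSq_covariant_energy _ _)
    simp [hz]
  have hwcomp : HasCompactSupport fun q => u (covariant (energy M q) q) :=
    hcomp.comp_isClosedEmbedding (isClosedEmbedding_covariant_energy M)
  have hucont : Continuous fun q => u (covariant (energy M q) q) :=
    hsmooth.continuous.comp (continuous_covariant_energy M)
  have hwcont : Continuous w := by
    refine continuous_iff_continuousAt.2 fun q => ?_
    rcases (energy_nonneg M q).eq_or_lt' with hq | hq
    -- The weight `1 / (2ω)` is singular only where the energy vanishes, and there `u` is zero on a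
    -- whole neighbourhood.
    · have hnot : covariant (energy M q) q ∉ tsupport u := fun hmem =>
        absurd (hsub hmem).1 (by simp [hq])
      have hev : ∀ᶠ r in 𝓝 q, w r = 0 := by
        have := (continuous_covariant_energy M).continuousAt.eventually
          ((isClosed_tsupport u).isOpen_compl.mem_nhds hnot)
        filter_upwards [this] with r hr
        simp [hw, image_eq_zero_of_notMem_tsupport hr]
      exact (continuousAt_const (y := (0 : ℝ))).congr
        (hev.mono fun r hr => hr.symm)
    · refine ContinuousAt.mul (ContinuousAt.div continuousAt_const ?_ (by positivity)) ?_
      · exact (continuous_const.mul (continuous_energy M)).continuousAt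
      · exact (hucont.pow 2).continuousAt
  have hwcomp' : HasCompactSupport w := by
    refine hwcomp.mono' ?_
    refine fun q hq => subset_tsupport _ fun hz => hq ?_
    simp [hw, hz]
  have hint : ∀ F : Spacetime → ℂ, Continuous F → MeasureTheory.Integrable
      fun q => (w q : ℂ) * F (covariant (energy M q) q) := by
    intro F hF
    refine Continuous.integrable_of_hasCompactSupport ?_ ?_
    · exact (Complex.continuous_ofReal.comp hwcont).mul
        (hF.comp (continuous_covariant_energy M))
    · exact (hwcomp'.comp_left (g := ((↑) : ℝ → ℂ)) rfl).mul_right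
  have hsum : ∫ q, (w q : ℂ) * S (covariant (energy M q) q) = 0 := by
    have hterm : ∀ i, c i * pauliJordan (m i) (D i g) h = C * ∫ q, (w q : ℂ) *
        (if m i = M then c i * P i (covariant (energy M q) q) else 0) := by
      intro i
      by_cases hi : m i = M
      · simp only [hi, if_true]
        have := hK i
        rw [hi] at this
        rw [this, ← mul_assoc, mul_comm (c i), mul_assoc, ← MeasureTheory.integral_const_mul]
        congr 2
        ext q
        simp only [hw]
        ring
      · simp [hi, hK0 i hi]
    have := h0 g h
    simp only [hterm] at this
    rw [← Finset.mul_sum, ← MeasureTheory.integral_finsetSum] at this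
    · simpa [hCne, hSdef, Finset.mul_sum] using this
    · intro i _
      refine hint (fun k => if m i = M then c i * P i k else 0) ?_
      split_ifs
      · exact continuous_const.mul (hP i)
      · exact continuous_const
  have hre : ∫ q, w q * ((starRingEnd ℂ) (S k₀) * S (covariant (energy M q) q)).re = 0 := by
    have h1 := congrArg (fun z => ((starRingEnd ℂ) (S k₀) * z).re) hsum
    simp only [mul_zero, Complex.zero_re] at h1
    rw [← MeasureTheory.integral_const_mul] at h1
    have h2 := integral_re (𝕜 := ℂ) ((hint S hScont).const_mul ((starRingEnd ℂ) (S k₀)))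
    simp only [RCLike.re_eq_complex_re] at h2
    rw [← h2] at h1
    rw [← h1]
    congr 1
    ext q
    rw [← Complex.re_ofReal_mul]
    ring_nf
  -- The integrand is nonnegative by the choice of the half plane and positive at `p`, contradicting
  -- `hre`.
  have hpos : 0 < ∫ q, w q * ((starRingEnd ℂ) (S k₀) * S (covariant (energy M q) q)).re := by
    refine Continuous.integral_pos_of_hasCompactSupport_nonneg_nonzero (x := p) ?_ ?_ ?_ ?_
    · exact hwcont.mul (Complex.continuous_re.comp
        (continuous_const.mul (hScont.comp (continuous_covariant_energy M))))
    · exact hwcomp'.mul_right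
    · intro q
      by_cases hq : u (covariant (energy M q) q) = 0
      · simp [hw, hq]
      · have := energy_nonneg M q
        exact mul_nonneg (by positivity) (hsub (subset_tsupport u hq)).2.1.le
    · have h1 : 0 < ((starRingEnd ℂ) (S k₀) * S k₀).re := by
        rw [mul_comm, Complex.mul_conj, Complex.ofReal_re]
        exact Complex.normSq_pos.2 hS
      have h2 : u k₀ = 1 := hone
      simp only [hw, ← hk₀, h2]
      positivity
  exact hpos.ne' hre


/-! ## Independence of Pauli-Jordan distributions -/

theorem energy_single_pos (m : ℝ) (i : Fin 3) :
    0 < energy m (EuclideanSpace.single i (-1)) := by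
  refine Real.sqrt_pos.2 (add_pos_of_nonneg_of_pos (sq_nonneg m) ?_)
  simp

theorem pauliJordan_independent {m M : ℝ} (hm : 0 ≤ m) (hM : 0 ≤ M) {a b : ℂ}
    (h : ∀ g h, a * pauliJordan m g h = b * pauliJordan M g h) :
    (m = M ∧ a = b) ∨ (a = 0 ∧ b = 0) := by
  have key : ∀ N : ℝ, 0 ≤ N → (if m = N then a else 0) + (if M = N then -b else 0) = 0 := by
    intro N hN
    have := sum_symbol_eq_zero (ι := Fin 2) ![m, M] (by simp [Fin.forall_fin_two, hm, hM]) ![a, -b]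
      (fun _ g => g) (fun _ _ => 1) (fun _ => continuous_const) (by simp)
      (by simp [Fin.sum_univ_two, h]) hN (energy_single_pos N 0)
    by_cases h1 : m = N <;> by_cases h2 : M = N <;> simp_all [Fin.sum_univ_two]
  by_cases hmM : m = M
  · have := key m hm
    simp only [hmM, if_true] at this
    exact .inl ⟨hmM, by linear_combination this⟩
  · have h1 := key m hm
    have h2 := key M hM
    simp only [hmM, Ne.symm hmM, if_true, if_false] at h1 h2
    exact .inr ⟨by simpa using h1, by simpa using h2⟩

/-- The entry is `k_0 + k_3`. The momentum `-e_3` has covariant component `k_3 = 1`, so the sum is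
at least `1` even for mass zero, where `+e_3` would give `0`. -/
theorem sum_sigma_covariant_ne_zero (m : ℝ) :
    ∑ ν, sigma ν 0 0 * (covariant (energy m (EuclideanSpace.single 2 (-1)))
      (EuclideanSpace.single 2 (-1)) ν : ℂ) ≠ 0 := by
  have h := energy_single_pos m 2
  rw [Fin.sum_univ_succ, Fin.sum_univ_three]
  simp only [covariant_zero, covariant_succ]
  simp [sigma]
  exact_mod_cast (by positivity : energy m (EuclideanSpace.single 2 (-1)) + 1 ≠ 0)

theorem pauliJordan_testD_independent {m M : ℝ} (hm : 0 ≤ m) (hM : 0 ≤ M) {a b : ℂ}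
    (h : ∀ g h, a * ∑ ν, sigma ν 0 0 * pauliJordan m (testD ν g) h
      = b * ∑ ν, sigma ν 0 0 * pauliJordan M (testD ν g) h) :
    (m = M ∧ a = b) ∨ (a = 0 ∧ b = 0) := by
  have key : ∀ N : ℝ, 0 ≤ N → (if m = N then a else 0) + (if M = N then -b else 0) = 0 := by
    intro N hN
    have := sum_symbol_eq_zero (ι := Fin 2 × Fin 4) (fun i => ![m, M] i.1)
      (by simp [Prod.forall, Fin.forall_fin_two, hm, hM]) (fun i => ![a, -b] i.1 * sigma i.2 0 0)
      (fun i g => testD i.2 g) (fun i k => Complex.I * (k i.2 : ℂ)) (by fun_prop)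
      (fun i g p0 p => minkowskiFourier_testD i.2 g p0 p)
      (fun g h' => by
        have := h g h'
        rw [Fintype.sum_prod_type]
        simp only [Fin.sum_univ_two, mul_assoc, ← Finset.mul_sum, Matrix.cons_val_zero,
          Matrix.cons_val_one, this, neg_mul, add_neg_cancel]) hN (energy_single_pos N 2)
    have hne := sum_sigma_covariant_ne_zero N
    rw [Fintype.sum_prod_type, Fin.sum_univ_two] at this
    refine (mul_eq_zero.1 ?_).resolve_right (mul_ne_zero Complex.I_ne_zero hne)
    rw [Finset.mul_sum, Finset.mul_sum]
    simp only [Matrix.cons_val_zero, Matrix.cons_val_one] at this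
    refine Eq.trans ?_ this
    rw [← Finset.sum_add_distrib]
    simp only [add_mul]
    rw [Finset.sum_add_distrib, Finset.sum_add_distrib]
    refine congrArg₂ _ (Finset.sum_congr rfl fun ν _ => ?_)
      (Finset.sum_congr rfl fun ν _ => ?_)
    · by_cases h1 : m = N
      · simp only [h1, if_true]; ring
      · simp only [h1, if_false]; ring
    · by_cases h1 : M = N
      · simp only [h1, if_true]; ring
      · simp only [h1, if_false]; ring
  by_cases hmM : m = M
  · have := key m hm
    simp only [hmM, if_true] at this
    exact .inl ⟨hmM, by linear_combination this⟩
  · have h1 := key m hm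
    have h2 := key M hM
    simp only [hmM, Ne.symm hmM, if_true, if_false] at h1 h2
    exact .inr ⟨by simpa using h1, by simpa using h2⟩

/-- Each derivative has symbol `i k`, so two of them give `-k_κ k_l`, which must cancel on the
shell. -/
theorem pauliJordan_secondOrder {M : ℝ} (hM : 0 ≤ M) {c : Fin 4 → Fin 4 → ℂ}
    (h : ∀ g h, ∑ κ, ∑ l, c κ l * pauliJordan M (testD κ (testD l g)) h = 0)
    {p : EuclideanSpace ℝ (Fin 3)} (hp : 0 < energy M p) :
    ∑ κ, ∑ l, c κ l * (covariant (energy M p) p κ * covariant (energy M p) p l) = 0 := by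
  have := sum_symbol_eq_zero (ι := Fin 4 × Fin 4) (fun _ => M) (fun _ => hM)
    (fun i => c i.1 i.2) (fun i g => testD i.1 (testD i.2 g))
    (fun i k => Complex.I * (k i.1 : ℂ) * (Complex.I * (k i.2 : ℂ))) (by fun_prop)
    (fun i g p0 p => by rw [minkowskiFourier_testD, minkowskiFourier_testD]; ring)
    (fun g h' => by rw [Fintype.sum_prod_type]; exact h g h') hM hp
  rw [Fintype.sum_prod_type] at this
  simp only [if_true] at this
  rw [← neg_eq_zero, ← this, ← Finset.sum_neg_distrib]
  refine Finset.sum_congr rfl fun κ _ => ?_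
  rw [← Finset.sum_neg_distrib]
  refine Finset.sum_congr rfl fun l _ => ?_
  linear_combination (-c κ l * covariant (energy M p) p κ * covariant (energy M p) p l)
    * Complex.I_sq

/-! ## Calculus of fields -/

section Calculus

variable {D : Type*} [AddCommGroup D] [Module ℂ D]

theorem pd_apply (ν : Fin 4) (φ : Field D) (g : TestFn) : pd ν φ g = -φ (testD ν g) := rfl

theorem comm_apply (X : Module.End ℂ D) (φ : Field D) (g : TestFn) :
    comm X φ g = X * φ g - φ g * X := rfl

theorem anticomm_apply (X : Module.End ℂ D) (φ : Field D) (g : TestFn) :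
    anticomm X φ g = X * φ g + φ g * X := rfl

theorem pd_smul (ν : Fin 4) (c : ℂ) (φ : Field D) : pd ν (c • φ) = c • pd ν φ := by
  ext1 g; simp [pd_apply]

theorem pd_sum {ι : Type*} (s : Finset ι) (ν : Fin 4) (φ : ι → Field D) :
    pd ν (∑ i ∈ s, φ i) = ∑ i ∈ s, pd ν (φ i) := by
  ext1 g; simp [pd_apply]

theorem comm_smul (X : Module.End ℂ D) (c : ℂ) (φ : Field D) :
    comm X (c • φ) = c • comm X φ := LinearMap.comp_smul _ _ _

theorem comm_sum {ι : Type*} (s : Finset ι) (X : Module.End ℂ D) (φ : ι → Field D) :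
    comm X (∑ i ∈ s, φ i) = ∑ i ∈ s, comm X (φ i) := by
  ext1 g; simp [comm_apply, Finset.mul_sum, Finset.sum_mul]

theorem comm_pd (X : Module.End ℂ D) (ν : Fin 4) (φ : Field D) :
    comm X (pd ν φ) = pd ν (comm X φ) := by
  ext1 g; simp only [comm_apply, pd_apply]; noncomm_ring

theorem comm_sum_smul_left {ι : Type*} (s : Finset ι) (c : ι → ℂ) (X : ι → Module.End ℂ D)
    (φ : Field D) : comm (∑ i ∈ s, c i • X i) φ = ∑ i ∈ s, c i • comm (X i) φ := by
  ext1 g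
  simp [comm_apply, Finset.mul_sum, Finset.sum_mul, smul_sub]

theorem anticomm_smul (X : Module.End ℂ D) (c : ℂ) (φ : Field D) :
    anticomm X (c • φ) = c • anticomm X φ := LinearMap.comp_smul _ _ _

theorem sigmaD_smul (a b : Fin 2) (c : ℂ) (φ : Field D) :
    sigmaD a b (c • φ) = c • sigmaD a b φ := by
  simp only [sigmaD, pd_smul, Finset.smul_sum]
  exact Finset.sum_congr rfl fun ν _ => smul_comm _ _ _

theorem sigmaD_sum {ι : Type*} (s : Finset ι) (a b : Fin 2) (φ : ι → Field D) :
    sigmaD a b (∑ i ∈ s, φ i) = ∑ i ∈ s, sigmaD a b (φ i) := by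
  simp only [sigmaD, pd_sum, Finset.smul_sum]
  exact Finset.sum_comm

theorem comm_sigmaD (X : Module.End ℂ D) (a b : Fin 2) (φ : Field D) :
    comm X (sigmaD a b φ) = sigmaD a b (comm X φ) := by
  simp only [sigmaD, comm_sum, comm_smul, comm_pd]

theorem box_smul (c : ℂ) (φ : Field D) : box (c • φ) = c • box φ := by
  simp only [box, pdUp, pd_smul, Finset.smul_sum]
  exact Finset.sum_congr rfl fun ν _ => smul_comm _ _ _

theorem box_sum {ι : Type*} (s : Finset ι) (φ : ι → Field D) :
    box (∑ i ∈ s, φ i) = ∑ i ∈ s, box (φ i) := by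
  simp only [box, pdUp, pd_sum, Finset.smul_sum]
  exact Finset.sum_comm

/-- The Jacobi identity for two odd operators and an even field. -/
theorem anticomm_comm_add (X Y : Module.End ℂ D) (φ : Field D) :
    anticomm X (comm Y φ) + anticomm Y (comm X φ) = comm (X * Y + Y * X) φ := by
  ext1 g; simp only [LinearMap.add_apply, comm_apply, anticomm_apply]; noncomm_ring

/-- The Jacobi identity for two odd operators and an odd field. -/
theorem comm_anticomm_add (X Y : Module.End ℂ D) (φ : Field D) :
    comm X (anticomm Y φ) + comm Y (anticomm X φ) = comm (X * Y + Y * X) φ := by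
  ext1 g; simp only [LinearMap.add_apply, comm_apply, anticomm_apply]; noncomm_ring

theorem CommIs.sum_left {ι : Type*} [Fintype ι] {φ : ι → Field D} {χ : Field D}
    {K : ι → TestFn → TestFn → ℂ} (c : ι → ℂ) (h : ∀ i, CommIs (φ i) χ (K i)) :
    CommIs (∑ i, c i • φ i) χ fun g h => ∑ i, c i * K i g h := fun g g' => by
  simp only [LinearMap.sum_apply, LinearMap.smul_apply, Finset.sum_mul, Finset.mul_sum,
    Finset.sum_smul, ← Finset.sum_sub_distrib, smul_mul_assoc, mul_smul_comm, ← smul_sub,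
    h _ g g', smul_smul]

theorem CommIs.sum_right {ι : Type*} [Fintype ι] {φ : Field D} {χ : ι → Field D}
    {K : ι → TestFn → TestFn → ℂ} (c : ι → ℂ) (h : ∀ i, CommIs φ (χ i) (K i)) :
    CommIs φ (∑ i, c i • χ i) fun g h => ∑ i, c i * K i g h := fun g g' => by
  simp only [LinearMap.sum_apply, LinearMap.smul_apply, Finset.sum_mul, Finset.mul_sum,
    Finset.sum_smul, ← Finset.sum_sub_distrib, smul_mul_assoc, mul_smul_comm, ← smul_sub,
    h _ g g', smul_smul]

theorem AnticommIs.sum_left {ι : Type*} [Fintype ι] {φ : ι → Field D} {χ : Field D}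
    {K : ι → TestFn → TestFn → ℂ} (c : ι → ℂ) (h : ∀ i, AnticommIs (φ i) χ (K i)) :
    AnticommIs (∑ i, c i • φ i) χ fun g h => ∑ i, c i * K i g h := fun g g' => by
  simp only [LinearMap.sum_apply, LinearMap.smul_apply, Finset.sum_mul, Finset.mul_sum,
    Finset.sum_smul, ← Finset.sum_add_distrib, smul_mul_assoc, mul_smul_comm, ← smul_add,
    h _ g g', smul_smul]

theorem AnticommIs.smul_left {φ χ : Field D} {K : TestFn → TestFn → ℂ} (c : ℂ)
    (h : AnticommIs φ χ K) : AnticommIs (c • φ) χ fun g h => c * K g h := fun g g' => by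
  simp only [LinearMap.smul_apply, smul_mul_assoc, mul_smul_comm, ← smul_add, h g g', smul_smul]

theorem AnticommIs.add_left {φ φ' χ : Field D} {K K' : TestFn → TestFn → ℂ}
    (h : AnticommIs φ χ K) (h' : AnticommIs φ' χ K') :
    AnticommIs (φ + φ') χ fun g h => K g h + K' g h := fun g g' => by
  rw [add_smul, ← h g g', ← h' g g', LinearMap.add_apply]
  noncomm_ring

theorem CommIs.pd_left {φ χ : Field D} {K : TestFn → TestFn → ℂ} (ν : Fin 4)
    (h : CommIs φ χ K) : CommIs (pd ν φ) χ fun g h => -K (testD ν g) h := fun g g' => by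
  rw [neg_smul, ← h, pd_apply]; noncomm_ring

theorem CommIs.pd_right {φ χ : Field D} {K : TestFn → TestFn → ℂ} (ν : Fin 4)
    (h : CommIs φ χ K) : CommIs φ (pd ν χ) fun g h => -K g (testD ν h) := fun g g' => by
  rw [neg_smul, ← h, pd_apply]; noncomm_ring

theorem AnticommIs.pd_left {φ χ : Field D} {K : TestFn → TestFn → ℂ} (ν : Fin 4)
    (h : AnticommIs φ χ K) : AnticommIs (pd ν φ) χ fun g h => -K (testD ν g) h := fun g g' => by
  rw [neg_smul, ← h, pd_apply]; noncomm_ring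

theorem CommIs.sigmaD_left {φ χ : Field D} {K : TestFn → TestFn → ℂ} (a b : Fin 2)
    (h : CommIs φ χ K) :
    CommIs (sigmaD a b φ) χ fun g h => ∑ ν, sigma ν a b * -K (testD ν g) h :=
  CommIs.sum_left _ fun ν => h.pd_left ν

theorem CommIs.sigmaD_right {φ χ : Field D} {K : TestFn → TestFn → ℂ} (a b : Fin 2)
    (h : CommIs φ χ K) :
    CommIs φ (sigmaD a b χ) fun g h => ∑ ν, sigma ν a b * -K g (testD ν h) :=
  CommIs.sum_right _ fun ν => h.pd_right ν

theorem AnticommIs.sigmaD_left {φ χ : Field D} {K : TestFn → TestFn → ℂ} (a b : Fin 2)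
    (h : AnticommIs φ χ K) :
    AnticommIs (sigmaD a b φ) χ fun g h => ∑ ν, sigma ν a b * -K (testD ν g) h :=
  AnticommIs.sum_left _ fun ν => h.pd_left ν

theorem AnticommIs.raise_left {φ : Fin 2 → Field D} {χ : Field D}
    {K : Fin 2 → TestFn → TestFn → ℂ} (h : ∀ a, AnticommIs (φ a) χ (K a)) (a : Fin 2) :
    AnticommIs (raise φ a) χ fun g h => ∑ b, epsUp a b * K b g h :=
  AnticommIs.sum_left _ h

theorem AnticommIs.swap {φ χ : Field D} {K : TestFn → TestFn → ℂ} (h : AnticommIs φ χ K) :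
    AnticommIs χ φ fun g h => K h g := fun g g' => by
  rw [← h g' g, add_comm]

theorem CommIs.congr {φ χ : Field D} {K K' : TestFn → TestFn → ℂ} (h : CommIs φ χ K)
    (hK : ∀ g g', K g g' = K' g g') : CommIs φ χ K' := fun g g' => by rw [h g g', hK]

theorem AnticommIs.unique [Nontrivial D] {φ χ : Field D} {K K' : TestFn → TestFn → ℂ}
    (h : AnticommIs φ χ K) (h' : AnticommIs φ χ K') (g g' : TestFn) : K g g' = K' g g' :=
  smul_left_injective ℂ (one_ne_zero (α := Module.End ℂ D)) ((h g g').symm.trans (h' g g'))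

theorem CommIs.unique [Nontrivial D] {φ χ : Field D} {K K' : TestFn → TestFn → ℂ}
    (h : CommIs φ χ K) (h' : CommIs φ χ K') (g g' : TestFn) : K g g' = K' g g' :=
  smul_left_injective ℂ (one_ne_zero (α := Module.End ℂ D)) ((h g g').symm.trans (h' g g'))

theorem AnticommIs.zero_left (χ : Field D) : AnticommIs 0 χ fun _ _ => 0 := fun g g' => by simp

theorem CommIs.zero_left (χ : Field D) : CommIs 0 χ fun _ _ => 0 := fun g g' => by simp

/-- The Jacobi identity for an odd operator, an even and an odd field which commute. -/
theorem AnticommIs.of_commIs_anticomm {X : Module.End ℂ D} {φ χ : Field D}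
    {K : TestFn → TestFn → ℂ} (h0 : CommIs φ χ fun _ _ => 0) (h : CommIs φ (anticomm X χ) K) :
    AnticommIs (comm X φ) χ fun g g' => -K g g' := fun g g' => by
  have h1 : X * (φ g * χ g' - χ g' * φ g) + (φ g * χ g' - χ g' * φ g) * X = 0 := by
    simp [h0 g g']
  rw [neg_smul, ← h g g', ← sub_eq_zero, ← h1, comm_apply, anticomm_apply]
  noncomm_ring

end Calculus


/-! ## Adjoints of fields -/

section Adjoint

variable {H : Type*} [NormedAddCommGroup H] [InnerProductSpace ℂ H] {T : SusyTheory H}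

@[simp] theorem conjTest_apply (g : TestFn) (x : Spacetime) :
    conjTest g x = (starRingEnd ℂ) (g x) := rfl

@[simp] theorem conjTest_conjTest (g : TestFn) : conjTest (conjTest g) = g := by
  ext x; simp

theorem conjTest_testD (ν : Fin 4) (g : TestFn) :
    conjTest (testD ν g) = testD ν (conjTest g) := by
  ext x
  have h : HasFDerivAt (conjTest g)
      ((Complex.conjCLE : ℂ →L[ℝ] ℂ).comp (fderiv ℝ g x)) x :=
    (Complex.conjCLE : ℂ →L[ℝ] ℂ).hasFDerivAt.comp x (g.differentiable x).hasFDerivAt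
  simp only [conjTest_apply, testD, LineDeriv.lineDerivOpCLM_apply,
    SchwartzMap.lineDerivOp_apply_eq_fderiv, h.fderiv]
  rfl

namespace SusyTheory

variable (T) in
theorem ext_form {x y : T.dom} (h : ∀ z, T.form z x = T.form z y) : x = y := by
  refine sub_eq_zero.1 (T.form_nondeg _ fun z => ?_)
  rw [← T.form_symm, map_sub, h, sub_self, map_zero]

/-- Needed so that a multiple of the identity operator determines its scalar, that is, so that the
kernel of a commutator is unique. -/
instance : Nontrivial T.dom := ⟨⟨T.vac, 0, T.vac_ne_zero⟩⟩

end SusyTheory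

namespace IsFieldAdjoint

variable {φ φ' φ'' : Field T.dom}

theorem symm (h : IsFieldAdjoint T φ φ') : IsFieldAdjoint T φ' φ := fun g x y => by
  rw [← T.form_symm, ← T.form_symm (φ (conjTest g) y)]
  congr 1
  simpa using (h (conjTest g) y x).symm

theorem apply_conj (h : IsFieldAdjoint T φ φ') (g : TestFn) (x y : T.dom) :
    T.form (φ (conjTest g) x) y = T.form x (φ' g y) := by
  simpa using h (conjTest g) x y

/-- Non-degeneracy of the form makes adjoints unique; this is how the action of `Qbar` is read off
from that of `Q`. -/
theorem unique (h : IsFieldAdjoint T φ φ') (h' : IsFieldAdjoint T φ φ'') : φ' = φ'' := by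
  ext1 g
  ext1 y
  refine T.ext_form fun z => ?_
  rw [← h.apply_conj, ← h'.apply_conj]

theorem smul (c : ℂ) (h : IsFieldAdjoint T φ φ') :
    IsFieldAdjoint T (c • φ) ((starRingEnd ℂ) c • φ') := fun g x y => by
  simp [h g x y]

theorem sum {ι : Type*} {s : Finset ι} {φ φ' : ι → Field T.dom}
    (h : ∀ i, IsFieldAdjoint T (φ i) (φ' i)) :
    IsFieldAdjoint T (∑ i ∈ s, φ i) (∑ i ∈ s, φ' i) := fun g x y => by
  simp [LinearMap.sum_apply, h _ g x y]

theorem pd (ν : Fin 4) (h : IsFieldAdjoint T φ φ') :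
    IsFieldAdjoint T (pd ν φ) (pd ν φ') := fun g x y => by
  simp only [pd_apply, LinearMap.neg_apply, map_neg, h _ x y, conjTest_testD]

theorem sigmaD (a b : Fin 2) (h : IsFieldAdjoint T φ φ') :
    IsFieldAdjoint T (sigmaD a b φ) (sigmaD b a φ') := by
  refine sum fun ν => ?_
  have : (starRingEnd ℂ) (sigma ν a b) = sigma ν b a := by
    fin_cases ν <;> fin_cases a <;> fin_cases b <;> simp [sigma]
  exact this ▸ (h.pd ν).smul _

/-- Adjunction reverses products, which costs a sign for commutators and none for anticommutators.
-/
theorem comm_Q (a : Fin 2) (h : IsFieldAdjoint T φ φ') :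
    IsFieldAdjoint T (comm (T.Q a) φ) (-comm (T.Qbar a) φ') := fun g x y => by
  simp [comm_apply, h g, T.Q_adjoint]

theorem anticomm_Q (a : Fin 2) (h : IsFieldAdjoint T φ φ') :
    IsFieldAdjoint T (anticomm (T.Q a) φ) (anticomm (T.Qbar a) φ') := fun g x y => by
  simp [anticomm_apply, h g, T.Q_adjoint, add_comm]

theorem commIs_zero {χ χ' : Field T.dom} (h : IsFieldAdjoint T φ φ')
    (h' : IsFieldAdjoint T χ χ') (hc : CommIs φ χ fun _ _ => 0) :
    CommIs φ' χ' fun _ _ => 0 := fun g g' => by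
  rw [zero_smul, sub_eq_zero]
  ext1 y
  refine T.ext_form fun z => ?_
  have hc' := hc (conjTest g) (conjTest g')
  rw [zero_smul, sub_eq_zero] at hc'
  simp only [Module.End.mul_apply]
  rw [← h.apply_conj, ← h'.apply_conj, ← h'.apply_conj, ← h.apply_conj,
    ← Module.End.mul_apply, ← Module.End.mul_apply, hc']

end IsFieldAdjoint

end Adjoint

/-! ## The coefficient matrices -/

section Coefficients

theorem AnticommIs.sum {D : Type*} [AddCommGroup D] [Module ℂ D] {ι : Type*} [Fintype ι]
    {φ : ι → Field D} {χ : Field D} {K : ι → TestFn → TestFn → ℂ}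
    (h : ∀ i, AnticommIs (φ i) χ (K i)) :
    AnticommIs (∑ i, φ i) χ fun g h => ∑ i, K i g h := by
  simpa using AnticommIs.sum_left (fun _ => 1) h

theorem sum_sub_ite_smul_eq_zero {D ι : Type*} [AddCommGroup D] [Module ℂ D] [Fintype ι]
    [DecidableEq ι] {N : ι → ℂ} {φ : ι → Field D} {c : ℂ} {i : ι}
    (h : ∑ k, N k • φ k = c • φ i) :
    ∑ k, (N k - if k = i then c else 0) • φ k = 0 := by
  ext1 g
  have h' := LinearMap.congr_fun h g
  simp only [LinearMap.sum_apply, LinearMap.smul_apply, LinearMap.zero_apply] at h' ⊢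
  simp [sub_smul, ite_smul, h']

theorem pauliJordanD_eq (ν : Fin 4) (m : ℝ) (g h : TestFn) :
    pauliJordanD ν m g h = -pauliJordan m (testD ν g) h := rfl

variable {H : Type*} [NormedAddCommGroup H] [InnerProductSpace ℂ H] {T : SusyTheory H}
  {s f : ℕ} {X : VectorRSFields T s f}

/-! ### Linear independence of derivatives of the fields -/

namespace VectorRSFields

theorem ccr_v_ψbar (X : VectorRSFields T s f) (j : Fin s) (A : Fin f) (μ ρ : Fin 4) (a : Fin 2) :
    CommIs (X.v j μ) (X.ψbar A ρ a) fun _ _ => 0 :=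
  (X.v_hermitian j μ).commIs_zero (X.ψ_majorana A ρ a) (X.ccr_v_ψ j A μ ρ a)

/-- The commutator with `v_l` isolates the `l`-th coefficient in front of a first derivative of `D`.
-/
theorem coeff_eq_zero_of_sum_sigmaD_v {N : Fin s → ℂ}
    (h : ∑ k, N k • sigmaD 0 0 (X.v k 0) = 0) (l : Fin s) : N l = 0 := by
  have h1 := CommIs.sum_left N fun k => (X.ccr_v_v k l 0 0).sigmaD_left 0 0
  rw [h] at h1
  have h2 := fun g g' => h1.unique (CommIs.zero_left _) g g'
  have h3 := pauliJordan_testD_independent (X.m_nonneg l) (X.m_nonneg l) (a := N l) (b := 0)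
    fun g g' => by
      have := h2 g g'
      rw [Finset.sum_eq_single l (fun k _ hk => by simp [hk]) (by simp)] at this
      simp only [if_true, metric, Complex.ofReal_one, Finset.mul_sum] at this
      rw [zero_mul, Finset.mul_sum]
      refine (mul_eq_zero.1 ?_).resolve_left
        (neg_ne_zero.2 (mul_ne_zero two_ne_zero Complex.I_ne_zero))
      rw [← this, Finset.mul_sum]
      exact Finset.sum_congr rfl fun ν _ => by ring
  rcases h3 with h3 | h3
  exacts [h3.2, h3.1]

/-- The anticommutator with `ψbar_C` isolates one coefficient, with symbol proportional to `(k_0 +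
k_3)²`. The anticommutator with `ψ_C` would carry a factor `M_C` and miss massless fields. -/
theorem coeff_eq_zero_of_sum_sigmaD_ψ {N : Fin f → ℂ}
    (h : ∑ B, N B • sigmaD 0 0 (X.ψ B 0 0) = 0) (C : Fin f) : N C = 0 := by
  have h1 := AnticommIs.sum_left N fun B => (X.ccr_ψ_ψbar B C 0 0 0 0).sigmaD_left 0 0
  rw [h] at h1
  have h2 := fun g g' => h1.unique (AnticommIs.zero_left _) g g'
  have h3 := pauliJordan_secondOrder (X.M_nonneg C)
    (c := fun κ ν => N C * (sigma κ 0 0 * sigma ν 0 0)) (fun g g' => by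
      have := h2 g g'
      rw [Finset.sum_eq_single C (fun B _ hB => by simp [hB]) (by simp)] at this
      simp only [if_true, metric, Complex.ofReal_one, pauliJordanD_eq, Finset.mul_sum,
        ← Finset.sum_neg_distrib] at this
      rw [← neg_eq_zero, Finset.sum_comm, ← this]
      simp only [← Finset.sum_neg_distrib]
      exact Finset.sum_congr rfl fun ν _ => Finset.sum_congr rfl fun κ _ => by ring)
    (energy_single_pos _ 2)
  have hne := sum_sigma_covariant_ne_zero (X.M C)
  refine (mul_eq_zero.1 ?_).resolve_right (mul_ne_zero hne hne)
  rw [← h3, Finset.sum_mul_sum, Finset.mul_sum]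
  refine Finset.sum_congr rfl fun κ _ => ?_
  rw [Finset.mul_sum]
  exact Finset.sum_congr rfl fun ν _ => by ring

/-! ### Jacobi identities with two fields: reduction to `A3` -/

namespace ReducedAction

variable {A1 : Matrix (Fin s) (Fin f) ℂ} {A2 A3 : Matrix (Fin f) (Fin s) ℂ}
  {A4 A5 : Matrix (Fin s) (Fin f) ℂ}

/-- Jacobi identity for `Q_0`, `v_0` and `ψ_{1 0}`: since `ε_{00} = 0` and `g_{01} = 0`, both `{Q_0,
ψ_{1 0}}` and the `A1` term drop out, leaving only second derivatives of `D_M` with coefficients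
`A4` and `A5`. -/
theorem A4_A5_eq_zero (hX : X.ReducedAction A1 A2 A3 A4 A5) (j : Fin s) (A : Fin f) :
    A4 j A = 0 ∧ A5 j A = 0 := by
  have h1 : AnticommIs (Complex.I • comm (T.Q 0) (X.v j 0)) (X.ψ A 1 0) fun _ _ => 0 := by
    have h0 : CommIs (X.v j 0) (anticomm (T.Q 0) (X.ψ A 1 0)) fun _ _ => 0 := by
      intro g g'
      simp [hX.Q_ψ, eps]
    simpa using (AnticommIs.of_commIs_anticomm (X.ccr_v_ψ j A 0 1 0) h0).smul_left Complex.I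
  rw [hX.Q_v] at h1
  have h2 := AnticommIs.sum fun B =>
    (((X.ccr_ψ_ψ B A 0 1 0 0).smul_left (A1 j B)).add_left
    ((AnticommIs.sum_left (fun b => sigmaLow 0 0 b) fun b =>
      AnticommIs.sum_left (fun ν => (metric ν ν : ℂ)) fun ν =>
        (AnticommIs.raise_left (fun d => (X.ccr_ψ_ψbar A B 1 ν 0 d).swap) b).pd_left ν).smul_left
          (A4 j B))).add_left
    ((AnticommIs.sum fun ν => AnticommIs.sum_left (fun b => sigma ν 0 b) fun b =>
        (AnticommIs.raise_left (fun d => (X.ccr_ψ_ψbar A B 1 ν 0 d).swap) b).pd_left 0).smul_left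
          (A5 j B))
  -- Row `0` is the `∂_μ` of the `A5` term, with columns `σ^l_{00}`; row `1` is the divergence `∂^ν`
  -- of the `A4` term, fixed to `ν = 1` by the metric, with columns `σ^l_{01}`.
  have h3 : ∀ g h : TestFn, ∑ κ, ∑ l, (![![A5 j A, 0, 0, A5 j A],
      ![0, A4 j A, -Complex.I * A4 j A, 0], 0, 0] : Fin 4 → Fin 4 → ℂ) κ l
        * pauliJordan (X.M A) (testD κ (testD l g)) h = 0 := by
    intro g h
    have := h2.unique h1 h g
    rw [Finset.sum_eq_single A (fun B _ hB => by simp [hB, hB.symm]) (by simp)] at this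
    simp only [if_true, Fin.sum_univ_two, Fin.sum_univ_four, pauliJordanD_eq,
      pauliJordan_testD_right] at this
    simp [metric, sigma, sigmaLow, eps, epsUp, -LineDeriv.lineDerivOpCLM_apply] at this
    simp only [Fin.sum_univ_four]
    simp [-LineDeriv.lineDerivOpCLM_apply]
    linear_combination -this
  -- At `k = (E, 0, 0, 1)` the relation is `A5 (E² + E) = 0`; at `k = (E, 1, 0, 0)` it is `A5 E² +
  -- A4 = 0`.
  have h4 := pauliJordan_secondOrder (X.M_nonneg A) h3 (energy_single_pos _ 2)
  have h5 := pauliJordan_secondOrder (X.M_nonneg A) h3 (energy_single_pos _ 0)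
  have e2 := energy_single_pos (X.M A) 2
  simp only [Fin.sum_univ_four, ← Fin.succ_zero_eq_one, ← Fin.succ_one_eq_two,
    show (3 : Fin 4) = Fin.succ 2 from rfl, covariant_zero, covariant_succ] at h4 h5
  simp at h4 h5
  have h6 : A5 j A = 0 := by
    have hne : ((energy (X.M A) (EuclideanSpace.single 2 (-1)) ^ 2
        + energy (X.M A) (EuclideanSpace.single 2 (-1)) : ℝ) : ℂ) ≠ 0 :=
      Complex.ofReal_ne_zero.2 (by positivity)
    refine (mul_eq_zero.1 ?_).resolve_right hne
    push_cast
    linear_combination h4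
  exact ⟨by simpa [h6] using h5, h6⟩

theorem Q_v' (hX : X.ReducedAction A1 A2 A3 A4 A5) (a : Fin 2) (j : Fin s) (μ : Fin 4) :
    Complex.I • comm (T.Q a) (X.v j μ) = ∑ A, A1 j A • X.ψ A μ a := by
  simp [hX.Q_v, (hX.A4_A5_eq_zero j _).1, (hX.A4_A5_eq_zero j _).2]

/-- Jacobi identity for `Q_0`, `v_j` and `ψbar_A`: first derivatives of `D` of masses `M_A` and
`m_j` are compared, so the masses agree unless both coefficients vanish. -/
theorem A1_A3 (hX : X.ReducedAction A1 A2 A3 A4 A5) (j : Fin s) (A : Fin f) :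
    (X.M A = X.m j ∧ A1 j A = 2 * A3 A j) ∨ (A1 j A = 0 ∧ 2 * A3 A j = 0) := by
  have h0 := CommIs.sum_right (A3 A) fun k => (X.ccr_v_v j k 0 0).sigmaD_right 0 0
  rw [← hX.Q_ψbar] at h0
  have h1 := (AnticommIs.of_commIs_anticomm (X.ccr_v_ψbar j A 0 0 0) h0).smul_left Complex.I
  rw [hX.Q_v'] at h1
  have h2 := AnticommIs.sum_left (A1 j) fun B => X.ccr_ψ_ψbar B A 0 0 0 0
  refine pauliJordan_testD_independent (X.M_nonneg A) (X.m_nonneg j) fun g h => ?_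
  have := h2.unique h1 g h
  rw [Finset.sum_eq_single A (fun B _ hB => by simp [hB]) (by simp),
    Finset.sum_eq_single j (fun B _ hB => by simp [hB.symm]) (by simp)] at this
  simp only [if_true, metric, Complex.ofReal_one, pauliJordanD_eq, pauliJordan_testD_right,
    one_mul, mul_one, mul_neg, neg_neg, Finset.sum_neg_distrib] at this
  simp only [this, Finset.mul_sum, ← Finset.sum_neg_distrib]
  refine Finset.sum_congr rfl fun ν _ => ?_
  linear_combination (-2 * A3 A j * sigma ν 0 0 * pauliJordan (X.m j) (testD ν g) h) * Complex.I_sq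

theorem A1_eq (hX : X.ReducedAction A1 A2 A3 A4 A5) (j : Fin s) (A : Fin f) :
    A1 j A = 2 * A3 A j := by
  rcases hX.A1_A3 j A with h | h
  exacts [h.2, h.1.trans h.2.symm]

theorem mass_eq (hX : X.ReducedAction A1 A2 A3 A4 A5) {j : Fin s} {A : Fin f}
    (h : A3 A j ≠ 0) : X.m j = X.M A := by
  rcases hX.A1_A3 j A with h' | h'
  exacts [h'.1.symm, absurd h'.2 (mul_ne_zero two_ne_zero h)]

/-- Jacobi identity for `Q_0`, `v_j` and `ψ_A`, with spinor indices chosen so that `ε_{01} = 1`. -/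
theorem A2_eq (hX : X.ReducedAction A1 A2 A3 A4 A5) (A : Fin f) (j : Fin s) :
    A2 A j = -Complex.I * X.M A * A3 A j := by
  have h0 := CommIs.sum_right (fun k => eps 0 1 * A2 A k) fun k => X.ccr_v_v j k 0 0
  rw [← hX.Q_ψ] at h0
  have h1 := (AnticommIs.of_commIs_anticomm (X.ccr_v_ψ j A 0 0 1) h0).smul_left Complex.I
  rw [hX.Q_v'] at h1
  have h2 := AnticommIs.sum_left (A1 j) fun B => X.ccr_ψ_ψ B A 0 0 0 1
  have h3 := pauliJordan_independent (X.m_nonneg j) (X.M_nonneg A)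
    (a := 2 * A2 A j) (b := -Complex.I * X.M A * A1 j A) fun g h => by
      have := h2.unique h1 g h
      rw [Finset.sum_eq_single A (fun B _ hB => by simp [hB]) (by simp),
        Finset.sum_eq_single j (fun B _ hB => by simp [hB.symm]) (by simp)] at this
      simp only [if_true, metric, eps, Complex.ofReal_one, Matrix.of_apply, Matrix.cons_val_zero,
        Matrix.cons_val_one] at this
      linear_combination -this + (2 * A2 A j * pauliJordan (X.m j) g h) * Complex.I_sq
  rw [hX.A1_eq] at h3
  have h4 : 2 * A2 A j = -Complex.I * X.M A * (2 * A3 A j) := by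
    rcases h3 with h3 | h3
    exacts [h3.2, h3.1.trans h3.2.symm]
  linear_combination h4 / 2

/-! ### The action of `Q` and `Qbar` through `A3`, and the relations forced by the supersymmetry
algebra -/

theorem comm_Q_v (hX : X.ReducedAction A1 A2 A3 A4 A5) (a : Fin 2) (j : Fin s) (μ : Fin 4) :
    comm (T.Q a) (X.v j μ) = ∑ A, (-2 * Complex.I * A3 A j) • X.ψ A μ a := by
  have h := congrArg (fun φ => -Complex.I • φ) (hX.Q_v' a j μ)
  simp only [smul_smul, neg_mul, Complex.I_mul_I, neg_neg, one_smul, hX.A1_eq,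
    Finset.smul_sum] at h
  rw [h]
  exact Finset.sum_congr rfl fun A _ => by congr 1; ring

theorem comm_Qbar_v (hX : X.ReducedAction A1 A2 A3 A4 A5) (a : Fin 2) (j : Fin s) (μ : Fin 4) :
    comm (T.Qbar a) (X.v j μ)
      = ∑ A, (-2 * Complex.I * (starRingEnd ℂ) (A3 A j)) • X.ψbar A μ a := by
  have h := (X.v_hermitian j μ).comm_Q a
  rw [hX.comm_Q_v] at h
  ext1 g
  have h' := LinearMap.congr_fun
    (h.unique (IsFieldAdjoint.sum fun A => (X.ψ_majorana A μ a).smul _)) g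
  rw [LinearMap.neg_apply, neg_eq_iff_eq_neg] at h'
  rw [h']
  simp [LinearMap.sum_apply, Complex.conj_ofNat]

theorem anticomm_Qbar_ψ (hX : X.ReducedAction A1 A2 A3 A4 A5) (a b : Fin 2) (A : Fin f)
    (μ : Fin 4) : anticomm (T.Qbar a) (X.ψ A μ b)
      = ∑ j, (starRingEnd ℂ) (A3 A j) • sigmaD b a (X.v j μ) := by
  have h := (X.ψ_majorana A μ b).symm.anticomm_Q a
  rw [hX.Q_ψbar] at h
  exact h.unique (IsFieldAdjoint.sum fun j => ((X.v_hermitian j μ).sigmaD a b).smul _)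

theorem anticomm_Qbar_ψbar (hX : X.ReducedAction A1 A2 A3 A4 A5) (a b : Fin 2) (A : Fin f)
    (μ : Fin 4) : anticomm (T.Qbar a) (X.ψbar A μ b)
      = ∑ j, (starRingEnd ℂ) (eps a b * A2 A j) • X.v j μ := by
  have h := (X.ψ_majorana A μ b).anticomm_Q a
  rw [hX.Q_ψ] at h
  exact h.unique (IsFieldAdjoint.sum fun j => (X.v_hermitian j μ).smul _)

/-- `Q_0² = 0` applied to `ψbar_A` returns a combination of `σ^ν ∂_ν ψ_B` whose coefficients are
these sums. -/
theorem sum_A3_mul_A3 (hX : X.ReducedAction A1 A2 A3 A4 A5) (A B : Fin f) :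
    ∑ j, A3 A j * A3 B j = 0 := by
  have h := comm_anticomm_add (T.Q 0) (T.Q 0) (X.ψbar A 0 0)
  rw [T.Q_Q, ← two_smul ℂ, hX.Q_ψbar] at h
  simp only [comm_sum, comm_smul, comm_sigmaD, hX.comm_Q_v, sigmaD_sum, sigmaD_smul,
    Finset.smul_sum, smul_smul] at h
  rw [Finset.sum_comm] at h
  simp only [← Finset.sum_smul] at h
  have h' := coeff_eq_zero_of_sum_sigmaD_ψ (h.trans (by ext1 g; simp [comm_apply])) B
  have h2 : (-4 * Complex.I) * ∑ j, A3 A j * A3 B j = 0 := by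
    rw [← h', Finset.mul_sum]
    exact Finset.sum_congr rfl fun j _ => by ring
  exact (mul_eq_zero.1 h2).resolve_left (by simp)

theorem comm_Q_Qbar {φ : Field T.dom} (hφ : IsQuantumField T φ) (a b : Fin 2) :
    comm (T.Q a * T.Qbar b + T.Qbar b * T.Q a) φ = (-2 * Complex.I) • sigmaD a b φ := by
  rw [T.Q_Qbar, comm_sum_smul_left, sigmaD, Finset.smul_sum]
  refine Finset.sum_congr rfl fun μ _ => ?_
  rw [hφ.momentum, smul_smul, smul_smul]
  congr 1
  ring

/-- `{Q_0, Qbar_0}` acts on `ψ_B` as a translation. Because `ε_{00} = 0`, only the order `[Q_0,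
{Qbar_0, ψ_B}]` contributes. -/
theorem sum_A3_mul_conj_A3 (hX : X.ReducedAction A1 A2 A3 A4 A5) (A B : Fin f) :
    ∑ j, A3 A j * (starRingEnd ℂ) (A3 B j) = if A = B then 1 else 0 := by
  have h := comm_anticomm_add (T.Q 0) (T.Qbar 0) (X.ψ B 0 0)
  rw [comm_Q_Qbar (X.ψ_field B 0 0), hX.anticomm_Qbar_ψ, hX.Q_ψ] at h
  simp only [show eps 0 0 = 0 from rfl, zero_mul, zero_smul, Finset.sum_const_zero] at h
  simp only [comm_sum, comm_smul, comm_sigmaD, hX.comm_Q_v, sigmaD_sum, sigmaD_smul,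
    Finset.smul_sum, smul_smul] at h
  rw [Finset.sum_comm] at h
  simp only [← Finset.sum_smul] at h
  rw [show comm (T.Qbar 0) (0 : Field T.dom) = 0 from LinearMap.comp_zero _, add_zero] at h
  have h2 := coeff_eq_zero_of_sum_sigmaD_ψ (sum_sub_ite_smul_eq_zero h) A
  have h3 : (-2 * Complex.I) * ∑ j, A3 A j * (starRingEnd ℂ) (A3 B j)
      = if A = B then -2 * Complex.I else 0 := by
    rw [Finset.mul_sum]
    refine Eq.trans ?_ (sub_eq_zero.1 h2)
    exact Finset.sum_congr rfl fun j _ => by ring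
  refine mul_left_cancel₀ (a := -2 * Complex.I) (by simp) (h3.trans ?_)
  split_ifs <;> simp

/-- `{Q_0, Qbar_0}` acts on `v_j` as a translation; both orders contribute, through `ψ` and through
`ψbar`, and give complex conjugate sums. -/
theorem sum_conj_A3_mul_A3 (hX : X.ReducedAction A1 A2 A3 A4 A5) (j k : Fin s) :
    ∑ A, (starRingEnd ℂ) (A3 A j) * A3 A k + ∑ A, A3 A j * (starRingEnd ℂ) (A3 A k)
      = if j = k then 1 else 0 := by
  have h := anticomm_comm_add (T.Q 0) (T.Qbar 0) (X.v j 0)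
  have hs : ∀ (Y : Module.End ℂ T.dom) (φ : Fin f → Field T.dom),
      anticomm Y (∑ A, φ A) = ∑ A, anticomm Y (φ A) := fun Y φ => by
    ext1 g; simp [anticomm_apply, Finset.mul_sum, Finset.sum_mul, Finset.sum_add_distrib]
  rw [comm_Q_Qbar (X.v_field j 0), hX.comm_Q_v, hX.comm_Qbar_v, hs, hs] at h
  simp only [anticomm_smul, hX.Q_ψbar, hX.anticomm_Qbar_ψ, Finset.smul_sum, smul_smul] at h
  rw [Finset.sum_comm, add_comm, Finset.sum_comm, ← Finset.sum_add_distrib] at h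
  simp only [← Finset.sum_smul, ← add_smul] at h
  have h2 := coeff_eq_zero_of_sum_sigmaD_v (sum_sub_ite_smul_eq_zero h) k
  refine mul_left_cancel₀ (a := -2 * Complex.I) (by simp) ?_
  rw [mul_ite, mul_one, mul_zero, mul_add, Finset.mul_sum, Finset.mul_sum, add_comm]
  simp only [mul_assoc, eq_comm (a := j)] at h2 ⊢
  exact sub_eq_zero.1 h2

end ReducedAction

end VectorRSFields

end Coefficients

/-! ### The complex vector fields and the decomposition into multiplets -/

section Multiplets

variable {H : Type*} [NormedAddCommGroup H] [InnerProductSpace ℂ H] {T : SusyTheory H}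

theorem IsQuantumField.sum_smul {ι : Type*} [Fintype ι] {φ : ι → Field T.dom} (c : ι → ℂ)
    (h : ∀ i, IsQuantumField T (φ i)) : IsQuantumField T (∑ i, c i • φ i) where
  tempered x y := by
    have : (fun g : TestFn => inner ℂ (x : H) (((∑ i, c i • φ i) g y : T.dom) : H))
        = fun g => ∑ i, c i * inner ℂ (x : H) ((φ i g y : T.dom) : H) := by
      ext g
      simp [LinearMap.sum_apply]
    rw [this]
    exact continuous_finsetSum _ fun i _ => continuous_const.mul ((h i).tempered x y)
  translate a g g' hg := by
    simp only [LinearMap.sum_apply, LinearMap.smul_apply, Finset.mul_sum, Finset.sum_mul,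
      mul_smul_comm, smul_mul_assoc, (h _).translate a g g' hg]
  momentum μ := by
    simp only [comm_sum, comm_smul, pd_sum, pd_smul, (h _).momentum, Finset.smul_sum]
    exact Finset.sum_congr rfl fun i _ => smul_comm _ _ _

theorem IsVectorField.sum_smul {ι : Type*} [Fintype ι] {v : ι → Fin 4 → Field T.dom}
    (c : ι → ℂ) (h : ∀ i, IsVectorField T (v i)) :
    IsVectorField T fun μ => ∑ i, c i • v i μ := fun A g g' hg μ => by
  simp only [LinearMap.sum_apply, LinearMap.smul_apply, Finset.mul_sum, Finset.sum_mul,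
    mul_smul_comm, smul_mul_assoc, h _ A g g' hg μ, Finset.smul_sum]
  rw [Finset.sum_comm]
  exact Finset.sum_congr rfl fun i _ => Finset.sum_congr rfl fun j _ => smul_comm _ _ _

variable {s f : ℕ} {X : VectorRSFields T s f}
  {A1 : Matrix (Fin s) (Fin f) ℂ} {A2 A3 : Matrix (Fin f) (Fin s) ℂ}
  {A4 A5 : Matrix (Fin s) (Fin f) ℂ}

namespace VectorRSFields

theorem commIs_sum_smul_v (X : VectorRSFields T s f) (c d : Fin s → ℂ) (μ ρ : Fin 4) :
    CommIs (∑ j, c j • X.v j μ) (∑ j, d j • X.v j ρ) fun g h =>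
      ∑ j, c j * d j * (2 * Complex.I * metric μ ρ * pauliJordan (X.m j) g h) := by
  refine (CommIs.sum_right d fun k => CommIs.sum_left c fun j => X.ccr_v_v j k μ ρ).congr
    fun g h => ?_
  refine Finset.sum_congr rfl fun j _ => ?_
  rw [Finset.sum_eq_single j (fun k _ hk => by simp [hk]) (by simp), if_pos rfl]
  ring

theorem commIs_sum_smul_v_ψ (X : VectorRSFields T s f) (c : Fin s → ℂ) (A : Fin f) (μ ρ : Fin 4)
    (a : Fin 2) : CommIs (∑ j, c j • X.v j μ) (X.ψ A ρ a) fun _ _ => 0 := by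
  simpa using CommIs.sum_left c fun j => X.ccr_v_ψ j A μ ρ a

namespace ReducedAction

theorem commIs_complexV_complexV (hX : X.ReducedAction A1 A2 A3 A4 A5) (A B : Fin f)
    (μ ρ : Fin 4) : CommIs (X.complexV A3 A μ) (X.complexV A3 B ρ) fun _ _ => 0 := by
  refine (X.commIs_sum_smul_v (A3 A) (A3 B) μ ρ).congr fun g h => ?_
  -- Only fields of mass `M_A` enter the combination, so one distribution factors out and an
  -- orthogonality relation remains.
  have : ∀ j, A3 A j * A3 B j * (2 * Complex.I * metric μ ρ * pauliJordan (X.m j) g h)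
      = A3 A j * A3 B j * (2 * Complex.I * metric μ ρ * pauliJordan (X.M A) g h) := fun j => by
    by_cases hj : A3 A j = 0
    · simp [hj]
    · rw [hX.mass_eq hj]
  simp only [this, ← Finset.sum_mul, hX.sum_A3_mul_A3, zero_mul]

theorem commIs_complexV_complexVdag (hX : X.ReducedAction A1 A2 A3 A4 A5) (A B : Fin f)
    (μ ρ : Fin 4) : CommIs (X.complexV A3 A μ) (X.complexVdag A3 B ρ) fun g h =>
      (if A = B then 1 else 0) * (2 * Complex.I * metric μ ρ * pauliJordan (X.M A) g h) := by
  refine (X.commIs_sum_smul_v (A3 A) (fun j => (starRingEnd ℂ) (A3 B j)) μ ρ).congr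
    fun g h => ?_
  have : ∀ j, A3 A j * (starRingEnd ℂ) (A3 B j)
        * (2 * Complex.I * metric μ ρ * pauliJordan (X.m j) g h)
      = A3 A j * (starRingEnd ℂ) (A3 B j)
        * (2 * Complex.I * metric μ ρ * pauliJordan (X.M A) g h) := fun j => by
    by_cases hj : A3 A j = 0
    · simp [hj]
    · rw [hX.mass_eq hj]
  simp only [this, ← Finset.sum_mul, hX.sum_A3_mul_conj_A3]

theorem decoupled (hX : X.ReducedAction A1 A2 A3 A4 A5) {A B : Fin f} (h : A ≠ B) :
    Decoupled (X.complexV A3 A) (X.complexVdag A3 A) (X.ψ A)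
      (X.complexV A3 B) (X.complexVdag A3 B) (X.ψ B) (X.ψbar B) where
  v_v := hX.commIs_complexV_complexV A B
  v_vdag μ ρ := by simpa [h] using hX.commIs_complexV_complexVdag A B μ ρ
  v_ψ := X.commIs_sum_smul_v_ψ _ B
  vdag_ψ := X.commIs_sum_smul_v_ψ _ B
  ψ_ψ μ ρ a b := by simpa [h] using X.ccr_ψ_ψ A B μ ρ a b
  ψ_ψbar μ ρ a b := by simpa [h] using X.ccr_ψ_ψbar A B μ ρ a b

/-- The commutator of an odd operator with a linear combination of the vector fields. -/
theorem comm_sum_smul_v {Y : Module.End ℂ T.dom} {μ : Fin 4} {φ : Fin f → Field T.dom}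
    {N : Fin f → Fin s → ℂ} (hY : ∀ j, comm Y (X.v j μ) = ∑ B, (-2 * Complex.I * N B j) • φ B)
    (c : Fin s → ℂ) (A : Fin f) {d : ℂ}
    (hc : ∀ B, ∑ j, c j * N B j = if A = B then d else 0) :
    comm Y (∑ j, c j • X.v j μ) = (-2 * Complex.I * d) • φ A := by
  simp only [comm_sum, comm_smul, hY, Finset.smul_sum, smul_smul]
  rw [Finset.sum_comm]
  simp only [← Finset.sum_smul]
  have : ∀ B, ∑ j, c j * (-2 * Complex.I * N B j)
      = if A = B then -2 * Complex.I * d else 0 := fun B => by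
    rw [← mul_ite_zero, ← hc, Finset.mul_sum]
    exact Finset.sum_congr rfl fun j _ => by ring
  simp only [this, ite_smul, zero_smul, Finset.sum_ite_eq, Finset.mem_univ, if_true]

theorem sum_conj_A3_mul_conj_A3 (hX : X.ReducedAction A1 A2 A3 A4 A5) (A B : Fin f) :
    ∑ j, (starRingEnd ℂ) (A3 A j) * (starRingEnd ℂ) (A3 B j) = 0 := by
  simpa using congrArg (starRingEnd ℂ) (hX.sum_A3_mul_A3 A B)

theorem sum_conj_A3_mul_A3_right (hX : X.ReducedAction A1 A2 A3 A4 A5) (A B : Fin f) :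
    ∑ j, (starRingEnd ℂ) (A3 A j) * A3 B j = if A = B then 1 else 0 := by
  simp only [eq_comm (a := A), ← hX.sum_A3_mul_conj_A3 B A, mul_comm]

theorem isRSVectorMultiplet (hX : X.ReducedAction A1 A2 A3 A4 A5) (A : Fin f) :
    IsRSVectorMultiplet T (X.M A) (X.complexV A3 A) (X.complexVdag A3 A) (X.ψ A) (X.ψbar A) where
  v_field μ := .sum_smul _ fun j => X.v_field j μ
  vdag_field μ := .sum_smul _ fun j => X.v_field j μ
  ψ_field := X.ψ_field A
  ψbar_field := X.ψbar_field A
  v_vector := .sum_smul _ X.v_vector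
  ψ_vectorSpinor := X.ψ_vectorSpinor A
  v_adjoint μ := .sum fun j => (X.v_hermitian j μ).smul _
  ψ_majorana := X.ψ_majorana A
  kleinGordon μ := by
    rw [KleinGordon, complexV, box_sum, Finset.smul_sum, ← Finset.sum_add_distrib]
    refine Finset.sum_eq_zero fun j _ => ?_
    by_cases hj : A3 A j = 0
    · rw [hj, box_smul, zero_smul, zero_smul, smul_zero, add_zero]
    · rw [box_smul, smul_comm, ← smul_add, ← hX.mass_eq hj,
        show box (X.v j μ) + _ = 0 from X.v_kleinGordon j μ, smul_zero]
  dirac := X.ψ_dirac A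
  ccr_v_vdag μ ρ := by simpa using hX.commIs_complexV_complexVdag A A μ ρ
  ccr_v_v := hX.commIs_complexV_complexV A A
  ccr_ψ_ψ μ ρ a b := by
    have := X.ccr_ψ_ψ A A μ ρ a b
    simp only [if_true] at this
    exact fun g h => by rw [this g h]; congr 1; ring
  ccr_ψ_ψbar μ ρ a b := by simpa using X.ccr_ψ_ψbar A A μ ρ a b
  ccr_v_ψ := X.commIs_sum_smul_v_ψ _ A
  ccr_vdag_ψ := X.commIs_sum_smul_v_ψ _ A
  Q_v a μ := by
    rw [complexV, comm_sum_smul_v (fun j => hX.comm_Q_v a j μ) _ A (d := 0)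
      (by simpa using hX.sum_A3_mul_A3 A), mul_zero, zero_smul]
  Qbar_vdag a μ := by
    rw [complexVdag, comm_sum_smul_v (fun j => hX.comm_Qbar_v a j μ) _ A (d := 0)
      (by simpa using hX.sum_conj_A3_mul_conj_A3 A), mul_zero, zero_smul]
  Q_vdag a μ := by
    rw [complexVdag, comm_sum_smul_v (fun j => hX.comm_Q_v a j μ) _ A
      (hX.sum_conj_A3_mul_A3_right A), smul_smul]
    congr 1
    linear_combination -2 * Complex.I_sq
  Qbar_v a μ := by
    rw [complexV, comm_sum_smul_v (fun j => hX.comm_Qbar_v a j μ) _ A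
      (hX.sum_A3_mul_conj_A3 A), smul_smul]
    congr 1
    linear_combination -2 * Complex.I_sq
  Q_ψ a b μ := by
    rw [hX.Q_ψ, complexV, Finset.smul_sum]
    refine Finset.sum_congr rfl fun j _ => ?_
    rw [hX.A2_eq, smul_smul]
    congr 1
    ring
  Qbar_ψbar a b μ := by
    rw [hX.anticomm_Qbar_ψbar, complexVdag, Finset.smul_sum]
    refine Finset.sum_congr rfl fun j _ => ?_
    have he : (starRingEnd ℂ) (eps a b) = eps a b := by
      fin_cases a <;> fin_cases b <;> simp [eps]
    rw [hX.A2_eq, smul_smul]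
    simp only [map_mul, map_neg, Complex.conj_I, Complex.conj_ofReal, he]
    congr 1
    ring
  Q_ψbar a b μ := by
    rw [hX.Q_ψbar, complexV, sigmaD_sum]
    simp only [sigmaD_smul]
  Qbar_ψ a b μ := by
    rw [hX.anticomm_Qbar_ψ, complexVdag, sigmaD_sum]
    simp only [sigmaD_smul]

/-- The four blocks are the orthogonality relations of the rows of `A3` and of their conjugates. -/
theorem fromRows_mul_conjTranspose (hX : X.ReducedAction A1 A2 A3 A4 A5) :
    Matrix.fromRows A3 (A3.map (starRingEnd ℂ))
      * (Matrix.fromRows A3 (A3.map (starRingEnd ℂ))).conjTranspose = 1 := by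
  ext (A | A) (B | B)
  · simpa [Matrix.mul_apply, Matrix.one_apply] using hX.sum_A3_mul_conj_A3 A B
  · simpa [Matrix.mul_apply, Matrix.one_apply] using hX.sum_A3_mul_A3 A B
  · simpa [Matrix.mul_apply, Matrix.one_apply] using hX.sum_conj_A3_mul_conj_A3 A B
  · simpa [Matrix.mul_apply, Matrix.one_apply] using hX.sum_conj_A3_mul_A3_right A B

theorem conjTranspose_mul_fromRows (hX : X.ReducedAction A1 A2 A3 A4 A5) :
    (Matrix.fromRows A3 (A3.map (starRingEnd ℂ))).conjTranspose
      * Matrix.fromRows A3 (A3.map (starRingEnd ℂ)) = 1 := by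
  ext j k
  simpa [Matrix.mul_apply, Matrix.one_apply] using hX.sum_conj_A3_mul_A3 j k

end VectorRSFields.ReducedAction
end Multiplets
end RSSusy

theorem mainTheorem8 {H : Type*} [NormedAddCommGroup H] [InnerProductSpace ℂ H] [CompleteSpace H]
    (T : RSSusy.SusyTheory H) {s f : ℕ} (X : RSSusy.VectorRSFields T s f)
    (A1 : Matrix (Fin s) (Fin f) ℂ) (A2 A3 : Matrix (Fin f) (Fin s) ℂ)
    (A4 A5 : Matrix (Fin s) (Fin f) ℂ) (hX : X.ReducedAction A1 A2 A3 A4 A5) :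
    s = 2 * f ∧
    -- the passage from the real fields to the complex fields and their adjoints is invertible
    (∃ B : Matrix (Fin s) (Fin f ⊕ Fin f) ℂ,
      Matrix.fromRows A3 (A3.map (starRingEnd ℂ)) * B = 1 ∧
      B * Matrix.fromRows A3 (A3.map (starRingEnd ℂ)) = 1) ∧
    (∀ A : Fin f, RSSusy.IsRSVectorMultiplet T (X.M A) (X.complexV A3 A) (X.complexVdag A3 A)
      (X.ψ A) (X.ψbar A)) ∧
    (∀ A B : Fin f, A ≠ B → RSSusy.Decoupled (X.complexV A3 A) (X.complexVdag A3 A) (X.ψ A)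
      (X.complexV A3 B) (X.complexVdag A3 B) (X.ψ B) (X.ψbar B)) := by
  refine ⟨?_, ⟨_, hX.fromRows_mul_conjTranspose, hX.conjTranspose_mul_fromRows⟩,
    hX.isRSVectorMultiplet, fun A B h => hX.decoupled h⟩
  -- A matrix with a two-sided inverse is square: the index types `Fin s` and `Fin f ⊕ Fin f` have
  -- equal cardinality.
  have := Matrix.square_of_invertible _ _ hX.conjTranspose_mul_fromRows
    hX.fromRows_mul_conjTranspose
  simpa [two_mul] using this
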